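/- **Setting.** All manifolds are finite-dimensional, Hausdorff and smooth. Let $M$ be a manifold and $n\ge 1$. For a $p$-vector $U$, $\iota_U$ denotes contraction, linear in $U$ with $\iota_{u_1\wedge\dots\wedge u_p}\gamma=\gamma(u_1,\dots,u_p,\cdot)$; write $\pounds_U\gamma=d\iota_U\gamma-(-1)^p\iota_U d\gamma$, and let $[U,V]$ be the Schouten–Nijenhuis bracket, with the sign convention $\iota_{[U,V]}\gamma=(-1)^{(p-1)q}\pounds_U\iota_V\gamma-\iota_V\pounds_U\gamma$ for a $p$-vector field $U$ and a $q$-vector field $V$. *Graded Dirac structures.* A regular graded Dirac structure of order $n$ on $M$ consists of smooth vector subbundles $S^a\subseteq\bigwedge^aT^*M$ $(1\le a\le n)$ with $S^a=\iota_{TM}S^{a+1}$ for $1\le a<n$ (the span of all contractions), and smooth vector bundle maps $$\sharp_a:S^a\to \textstyle\bigwedge^{n+1-a}TM/K_{n+1-a},\qquad K_p=\{U\in\textstyle\bigwedge^pTM:\iota_US^p=0\},$$ such that, for $1\le a,b\le n$ with $a+b\ge n+1$, $p=n+1-a$, $q=n+1-b$: 1. $\iota_{\sharp_a(\alpha)}\beta=(-1)^{pq}\iota_{\sharp_b(\beta)}\alpha$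 for all $\alpha\in S^a$, $\beta\in S^b$ in the same fibre; 2. if $\alpha,\beta$ are smooth sections of $S^a,S^b$ and $U,V$ are smooth multivector fields with $\sharp_a(\alpha)=U+K_p$, $\sharp_b(\beta)=V+K_q$, then $\theta:=(-1)^{(p-1)q}\pounds_U\beta+(-1)^q\pounds_V\alpha-\frac{(-1)^q}{2}d\big(\iota_V\alpha+(-1)^{pq}\iota_U\beta\big)$ takes values in $S^{a+b-n}$ and $\sharp_{a+b-n}(\theta)=[U,V]+K_{p+q-1}$. For $0\le a\le n-1$, a smooth $a$-form $\alpha$ is *Hamiltonian* ($\alpha\in\Omega^a_H(M)$) if $d\alpha$ takes values in $S^{a+1}$. *Fibered structures.* Let $\tau:M\to X$ be a smooth surjective submersion onto an $n$-dimensional manifold $X$. A form on $M$ is *semi-basic* if it vanishes whenever one argument lies in $\ker d\tau$, and *basic* if it is $\tau^*\beta$ for a smooth form $\beta$ on $X$. The structure is *fibered over $X$* if every form in $S^a$ vanishes whenever two of its arguments lie in $\ker d\tau$, and every semi-basic $a$-form belongs to $S^a$ $(1\le a\le n)$. *Extensions.* For $\theta\in\bigwedge^kT^*M$, $u\in\bigwedge^pTM/K_p$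 and $\gamma\in S^b$, $p\le b\le n$, put $\iota_{\theta\otimes u}\gamma=\theta\wedge\iota_u\gamma$. For $a\ge1$ let $(S^1)^{\wedge a}\subseteq\bigwedge^aT^*M$ be the span of the products of $a$ elements of $S^1$. The canonical extension $\widetilde\sharp_1:(S^1)^{\wedge a}\to\bigwedge^{a-1}T^*M\otimes\bigwedge^nTM/K_n$ is determined by $\iota_{\sharp_n(\alpha)}\Theta=(-1)^{n+1-a}\iota_{\widetilde\sharp_1(\Theta)}\alpha$ for all $\alpha\in S^n$. Let $$S^{n+1}[n]=\Big\{\Theta\in(S^1)^{\wedge(n+1)}:\ \exists\,T\in T^*M\otimes TM/K_1\ \text{ with }\ \iota_T\alpha=\iota_{\widetilde\sharp_1(\Theta)}\alpha\ \ \forall\alpha\in S^n\Big\}.$$ An *extension* $\widetilde\sharp_n$ is a smooth, fibrewise linear map $\widetilde\sharp_n:S^{n+1}[n]\to T^*M\otimes TM/K_1$ with $\iota_{\widetilde\sharp_n(\Theta)}\alpha=\iota_{\widetilde\sharp_1(\Theta)}\alpha$ for all $\Theta\in S^{n+1}[n]$ and $\alpha\in S^n$ in the same fibre; smoothness means that every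 smooth local section of $S^{n+1}[n]$ goes to a section that near each point is a finite sum $\sum_i\theta_i\otimes(u_i+K_1)$ with $\theta_i$ smooth $1$-forms and $u_i$ smooth vector fields. It *takes vertical values* if its values lie in the image of $T^*M\otimes\ker d\tau$ in $T^*M\otimes TM/K_1$. *Hamiltonians and brackets.* Let $\mathbb 1_n\in\bigwedge^nT^*M\otimes\bigwedge^nTM$ be the identity tensor. A *Hamiltonian* is a smooth $n$-form $\mathcal H$ on $M$ such that $d\mathcal H$ takes values in $S^{n+1}[n]$, the form $-\widetilde\sharp_1(d\mathcal H)+\mathbb 1_n$ with values in $\bigwedge^nTM/K_n$ is semi-basic, and $\iota_{-\widetilde\sharp_1(d\mathcal H)+\mathbb 1_n}\omega=\omega$ for every semi-basic $n$-form $\omega$. For $\alpha\in\Omega_H^a(M)$ and an extension $\widetilde\sharp_n$, put $$\{\alpha,\mathcal H\}_{\widetilde\sharp_n}:=(-1)^{(n-1)-n}\,\iota_{\widetilde\sharp_n(d\mathcal H)}d\alpha=-\,\iota_{\widetilde\sharp_n(d\mathcal H)}d\alpha .$$ **Theorem.** Let $\tau:M\to X$, $\dim X=n$, carry a regular graded Dirac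 structure of order $n$ fibered over $X$, and let $\alpha\in\Omega^a_H(M)$, $0\le a\le n-1$, be *special Hamiltonian*: $\alpha\wedge\varepsilon\in\Omega_H^{n-1}(M)$ for every closed basic $(n-1-a)$-form $\varepsilon$. Then for every Hamiltonian $\mathcal H$ and any two extensions $\widetilde\sharp_n,\widetilde\sharp_n'$ that take vertical values, $$\{\alpha,\mathcal H\}_{\widetilde\sharp_n}=\{\alpha,\mathcal H\}_{\widetilde\sharp_n'} .$$ -/

import Mathlib

open scoped Manifold ContDiff TensorProduct Topology

set_option linter.unusedSectionVars false

noncomputable section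

namespace GradedDirac

section LinearAlgebra

variable {V : Type*} [NormedAddCommGroup V] [NormedSpace ℝ V] [FiniteDimensional ℝ V]

/-- Alternating `a`-forms on `V`, i.e. the fibre `⋀ᵃ V*`. -/
abbrev AltForm (V : Type*) [NormedAddCommGroup V] [NormedSpace ℝ V] (a : ℕ) : Type _ :=
  V [⋀^Fin a]→L[ℝ] ℝ

/-- `p`-vectors on `V`, i.e. the fibre `⋀ᵖ V`. -/
abbrev MultiVec (V : Type*) [NormedAddCommGroup V] [NormedSpace ℝ V] (p : ℕ) : Type _ :=
  ⋀[ℝ]^p V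

theorem alternatingMap_continuous {ι : Type*} [Fintype ι] (f : V [⋀^ι]→ₗ[ℝ] ℝ) :
    Continuous f := by
  classical
  let b := Module.finBasis ℝ V
  have key : ∀ v : ι → V, f v =
      ∑ r : ι → Fin (Module.finrank ℝ V), (∏ i, b.repr (v i) (r i)) * f (fun i => b (r i)) := by
    intro v
    have hv : v = fun i => ∑ j, b.repr (v i) j • b j := by
      funext i; exact (b.sum_repr (v i)).symm
    conv_lhs => rw [hv]
    have h := f.toMultilinearMap.map_sum (fun (i : ι) (j : Fin (Module.finrank ℝ V)) => b.repr (v i) j • b j)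
    refine h.trans (Finset.sum_congr rfl fun r _ => ?_)
    have h2 := f.toMultilinearMap.map_smul_univ (fun i => b.repr (v i) (r i)) (fun i => b (r i))
    simpa [smul_eq_mul] using h2
  have hc : ∀ j, Continuous fun x : V => b.repr x j := fun j =>
    (b.coord j).continuous_of_finiteDimensional
  have : (f : (ι → V) → ℝ) = fun v => _ := funext key
  rw [this]
  exact continuous_finsetSum _ fun r _ =>
    (continuous_finsetProd _ fun i _ => (hc (r i)).comp (continuous_apply i)).mul continuous_const

/-- In finite dimension every alternating map is continuous. -/
def ofAlternating {a : ℕ} : (V [⋀^Fin a]→ₗ[ℝ] ℝ) →ₗ[ℝ] AltForm V a where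
  toFun f := { f with cont := alternatingMap_continuous f }
  map_add' _ _ := rfl
  map_smul' _ _ := rfl

@[simp] theorem ofAlternating_apply {a : ℕ} (f : V [⋀^Fin a]→ₗ[ℝ] ℝ) (v : Fin a → V) :
    ofAlternating f v = f v := rfl

/-- The exterior product of forms (sum over shuffles, no numerical factor in front), with values
in the forms of degree `c = a + b`. -/
def wedge {a b c : ℕ} (h : a + b = c) : AltForm V a →ₗ[ℝ] AltForm V b →ₗ[ℝ] AltForm V c :=
  LinearMap.mk₂ ℝ
    (fun θ η => ofAlternating (((LinearMap.mul' ℝ ℝ).compAlternatingMap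
      (θ.toAlternatingMap.domCoprod η.toAlternatingMap)).domDomCongr
        (finSumFinEquiv.trans (finCongr h))))
    (fun θ θ' η => by ext; simp [← AlternatingMap.domCoprod'_apply, TensorProduct.add_tmul])
    (fun r θ η => by ext; simp [← AlternatingMap.domCoprod'_apply, ← TensorProduct.smul_tmul'])
    (fun θ η η' => by ext; simp [← AlternatingMap.domCoprod'_apply, TensorProduct.tmul_add])
    (fun r θ η => by ext; simp [← AlternatingMap.domCoprod'_apply, TensorProduct.tmul_smul])

/-- The pairing of forms and multivectors: `⟨β, u₁ ∧ ⋯ ∧ uₚ⟩ = β (u₁, …, uₚ)`. -/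
def pairing {p : ℕ} : AltForm V p →ₗ[ℝ] MultiVec V p →ₗ[ℝ] ℝ :=
  exteriorPower.alternatingMapLinearEquiv.toLinearMap ∘ₗ
    ContinuousAlternatingMap.toAlternatingMapLinear

/-- The family `(u₁, …, uₚ, w₁, …, wₘ)`. -/
def joinArgs {p m b : ℕ} (h : p + m = b) (u : Fin p → V) (w : Fin m → V) : Fin b → V :=
  Sum.elim u w ∘ (finSumFinEquiv.trans (finCongr h)).symm

/-- The alternating map `(u₁, …, uₚ) ↦ γ (u₁, …, uₚ, ·)`. -/
def contractAlt {p m b : ℕ} (h : p + m = b) (γ : AltForm V b) : V [⋀^Fin p]→ₗ[ℝ] AltForm V m :=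
  let e := (finSumFinEquiv.trans (finCongr h)).symm
  let g : V [⋀^Fin p ⊕ Fin m]→ₗ[ℝ] ℝ := γ.toAlternatingMap.domDomCongr e
  { toFun := fun u => ofAlternating
      { toFun := fun w => γ (joinArgs h u w)
        map_update_add' := by
          intro inst w i x y
          obtain rfl : inst = instDecidableEqFin m := Subsingleton.elim _ _
          change g (Sum.elim u _) = g (Sum.elim u _) + g (Sum.elim u _)
          simp only [← Sum.update_elim_inr]
          exact g.map_update_add _ _ _ _
        map_update_smul' := by
          intro inst w i x y
          obtain rfl : inst = instDecidableEqFin m := Subsingleton.elim _ _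
          change g (Sum.elim u _) = x • g (Sum.elim u _)
          simp only [← Sum.update_elim_inr]
          exact g.map_update_smul _ _ _ _
        map_eq_zero_of_eq' := by
          intro w i j hw hij
          exact g.map_eq_zero_of_eq (Sum.elim u w) (i := Sum.inr i) (j := Sum.inr j) hw
            (by simpa using hij) }
    map_update_add' := by
      intro inst u i x y
      obtain rfl : inst = instDecidableEqFin p := Subsingleton.elim _ _
      ext w
      change g (Sum.elim _ w) = g (Sum.elim _ w) + g (Sum.elim _ w)
      simp only [← Sum.update_elim_inl]
      exact g.map_update_add _ _ _ _
    map_update_smul' := by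
      intro inst u i x y
      obtain rfl : inst = instDecidableEqFin p := Subsingleton.elim _ _
      ext w
      change g (Sum.elim _ w) = x • g (Sum.elim _ w)
      simp only [← Sum.update_elim_inl]
      exact g.map_update_smul _ _ _ _
    map_eq_zero_of_eq' := by
      intro u i j hu hij
      ext w
      exact g.map_eq_zero_of_eq (Sum.elim u w) (i := Sum.inl i) (j := Sum.inl j) hu
            (by simpa using hij) }

/-- The contraction `ι_U γ`, linear in both arguments, determined by
`ι_{u₁ ∧ ⋯ ∧ uₚ} γ = γ (u₁, …, uₚ, ·)`; thus `ι_{u ∧ v} = ι_v ι_u`. Note the order of the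
arguments: `contract h γ U` is `ι_U γ`. -/
def contract {p m b : ℕ} (h : p + m = b) :
    AltForm V b →ₗ[ℝ] MultiVec V p →ₗ[ℝ] AltForm V m :=
  exteriorPower.alternatingMapLinearEquiv.toLinearMap ∘ₗ
    { toFun := contractAlt h
      map_add' := fun _ _ => rfl
      map_smul' := fun _ _ => rfl }


theorem wedge_zero_form {c : ℕ} (h : c + 0 = c) (θ : AltForm V c) (η : AltForm V 0) :
    wedge h θ η = η 0 • θ := by
  have hsub : Subsingleton (Equiv.Perm.ModSumCongr (Fin c) (Fin 0)) := by
    refine ⟨fun x y => ?_⟩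
    induction x using Quotient.inductionOn'
    induction y using Quotient.inductionOn'
    refine Quotient.sound' ?_
    rw [QuotientGroup.leftRel_apply]
    exact Equiv.Perm.mem_sumCongrHom_range_of_perm_mapsTo_inl (by
      rintro _ ⟨x, rfl⟩
      rcases hx : (_ : Equiv.Perm (Fin c ⊕ Fin 0)) (Sum.inl x) with z | z
      · exact ⟨z, rfl⟩
      · exact z.elim0)
  ext v
  change (LinearMap.mul' ℝ ℝ) ((θ.toAlternatingMap.domCoprod η.toAlternatingMap)
    (v ∘ (finSumFinEquiv.trans (finCongr h)))) = _
  have hs : ∑ σ, AlternatingMap.domCoprod.summand θ.toAlternatingMap η.toAlternatingMap σ =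
      AlternatingMap.domCoprod.summand θ.toAlternatingMap η.toAlternatingMap
        (Quotient.mk'' 1 : Equiv.Perm.ModSumCongr (Fin c) (Fin 0)) :=
    Fintype.sum_subsingleton _ _
  rw [AlternatingMap.domCoprod_apply]
  refine (congrArg (fun f => (LinearMap.mul' ℝ ℝ)
    (f (v ∘ (finSumFinEquiv.trans (finCongr h))))) hs).trans ?_
  rw [AlternatingMap.domCoprod.summand_mk'']
  rw [Equiv.Perm.sign_one, one_smul]
  change θ v * η (fun i : Fin 0 => v (finSumFinEquiv (m := c) (n := 0) (Sum.inr i))) = η 0 * θ v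
  rw [mul_comm, Subsingleton.elim (fun i : Fin 0 => v _) 0]

/-- The annihilator `{U ∈ ⋀ᵖ V : ι_U S = 0}` of a space `S` of `p`-forms. -/
def annihilator {p : ℕ} (S : Submodule ℝ (AltForm V p)) : Submodule ℝ (MultiVec V p) where
  carrier := {U | ∀ β ∈ S, pairing β U = 0}
  add_mem' hU hW β hβ := by simp [hU β hβ, hW β hβ]
  zero_mem' β _ := by simp
  smul_mem' r U hU β hβ := by simp [hU β hβ]

theorem contract_ιMulti {p m b : ℕ} (h : p + m = b) (γ : AltForm V b) (u : Fin p → V)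
    (w : Fin m → V) :
    contract h γ (exteriorPower.ιMulti ℝ p u) w = γ (joinArgs h u w) := by
  change exteriorPower.alternatingMapLinearEquiv (contractAlt h γ) _ w = _
  rw [exteriorPower.alternatingMapLinearEquiv_apply_ιMulti]
  rfl

theorem pairing_ιMulti {p : ℕ} (γ : AltForm V p) (u : Fin p → V) :
    pairing γ (exteriorPower.ιMulti ℝ p u) = γ u := by
  change exteriorPower.alternatingMapLinearEquiv γ.toAlternatingMap _ = _
  rw [exteriorPower.alternatingMapLinearEquiv_apply_ιMulti]
  rfl

theorem contract_zero {p : ℕ} (h : p + 0 = p) (γ : AltForm V p) (U : MultiVec V p)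
    (w : Fin 0 → V) : contract h γ U w = pairing γ U := by
  have key : ∀ U, U ∈ Submodule.span ℝ (Set.range (exteriorPower.ιMulti ℝ p (M := V))) →
      contract h γ U w = pairing γ U := by
    intro U hU
    induction hU using Submodule.span_induction with
    | mem x hx =>
      obtain ⟨u, rfl⟩ := hx
      rw [contract_ιMulti, pairing_ιMulti]
      congr 1
      funext i
      have : (finSumFinEquiv.trans (finCongr h)).symm i = Sum.inl i := by
        rw [Equiv.symm_apply_eq]; rfl
      change Sum.elim u w ((finSumFinEquiv.trans (finCongr h)).symm i) = _
      rw [this]; rfl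
    | zero => simp
    | add x y _ _ hx hy => simp [hx, hy]
    | smul r x _ hx => simp [hx]
  exact key U (by rw [exteriorPower.ιMulti_span]; trivial)

theorem joinArgs_cons {p m : ℕ} : ∃ σ : Equiv.Perm (Fin (p + m + 1)),
    ∀ (u : Fin p → V) (x : V) (w : Fin m → V),
      joinArgs (rfl : p + (m + 1) = p + m + 1) u (Fin.cons x w) =
        (Fin.cons x (joinArgs (rfl : p + m = p + m) u w) : Fin (p + m + 1) → V) ∘ σ := by
  let e₁ : Fin p ⊕ Fin (m + 1) ≃ Fin (p + m + 1) :=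
    finSumFinEquiv.trans (finCongr (rfl : p + (m + 1) = p + m + 1))
  let e₂ : Fin p ⊕ Fin m ≃ Fin (p + m) := finSumFinEquiv.trans (finCongr (rfl : p + m = p + m))
  let f : Fin p ⊕ Fin (m + 1) → Fin (p + m + 1) :=
    Sum.elim (fun i => (e₂ (Sum.inl i)).succ) (Fin.cons 0 (fun j => (e₂ (Sum.inr j)).succ))
  have hf : Function.Injective f := by
    rintro (i | i) (j | j) hij
    · simpa [f] using hij
    · induction j using Fin.cases with
      | zero => simp [f] at hij
      | succ j => simp [f] at hij
    · induction i using Fin.cases with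
      | zero => simp [f] at hij; exact absurd hij.symm (Fin.succ_ne_zero _)
      | succ i => simp [f] at hij
    · induction i using Fin.cases with
      | zero => 
        induction j using Fin.cases with
        | zero => rfl
        | succ j => simp [f] at hij; exact absurd hij.symm (Fin.succ_ne_zero _)
      | succ i => 
        induction j using Fin.cases with
        | zero => simp [f] at hij
        | succ j => simpa [f] using hij
  have hb : Function.Bijective f := by
    rw [Fintype.bijective_iff_injective_and_card]
    exact ⟨hf, by simp; omega⟩
  refine ⟨e₁.symm.trans (Equiv.ofBijective f hb), fun u x w => ?_⟩
  funext k
  obtain ⟨s, rfl⟩ := e₁.surjective k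
  have hl : joinArgs (rfl : p + (m + 1) = p + m + 1) u (Fin.cons x w : Fin (m + 1) → V) (e₁ s) =
      Sum.elim u (Fin.cons x w : Fin (m + 1) → V) s := by
    change Sum.elim u (Fin.cons x w : Fin (m + 1) → V) (e₁.symm (e₁ s)) = _
    rw [Equiv.symm_apply_apply]
  have hr : ∀ t, joinArgs (rfl : p + m = p + m) u w (e₂ t) = Sum.elim u w t := by
    intro t
    change Sum.elim u w (e₂.symm (e₂ t)) = _
    rw [Equiv.symm_apply_apply]
  rw [hl]
  change _ = (Fin.cons x (joinArgs (rfl : p + m = p + m) u w) : Fin (p + m + 1) → V)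
    (f (e₁.symm (e₁ s)))
  rw [Equiv.symm_apply_apply]
  rcases s with i | i
  · simp [f, hr]
  · induction i using Fin.cases with
    | zero => simp [f]
    | succ j => simp [f, hr]

theorem contract_cons {p m : ℕ} (γ : AltForm V (p + m + 1)) : ∃ s : ℝ,
    ∀ (U : MultiVec V p) (x : V) (w : Fin m → V),
      contract (rfl : p + (m + 1) = p + m + 1) γ U (Fin.cons x w) =
        s * contract (rfl : p + m = p + m) (γ.curryLeft x) U w := by
  obtain ⟨σ, hσ⟩ := joinArgs_cons (V := V) (p := p) (m := m)
  refine ⟨((Equiv.Perm.sign σ : ℤ) : ℝ), fun U x w => ?_⟩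
  have key : ∀ U, U ∈ Submodule.span ℝ (Set.range (exteriorPower.ιMulti ℝ p (M := V))) →
      contract (rfl : p + (m + 1) = p + m + 1) γ U (Fin.cons x w) =
        ((Equiv.Perm.sign σ : ℤ) : ℝ) *
          contract (rfl : p + m = p + m) (γ.curryLeft x) U w := by
    intro U hU
    induction hU using Submodule.span_induction with
    | mem y hy =>
      obtain ⟨u, rfl⟩ := hy
      rw [contract_ιMulti, contract_ιMulti, hσ]
      have := γ.toAlternatingMap.map_perm
        (Fin.cons x (joinArgs (rfl : p + m = p + m) u w) : Fin (p + m + 1) → V) σ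
      refine this.trans ?_
      rw [Units.smul_def, zsmul_eq_mul]
      rfl
    | zero => simp
    | add a b _ _ ha hb => simp [ha, hb, mul_add]
    | smul r a _ ha => simp [ha]; ring
  exact key U (by rw [exteriorPower.ιMulti_span]; trivial)

theorem contract_eq_zero {p b : ℕ} (S : ∀ a, Submodule ℝ (AltForm V a))
    (hS : ∀ a, p ≤ a → a < b → ∀ α ∈ S (a + 1), ∀ v : V, α.curryLeft v ∈ S a)
    {m : ℕ} (h : p + m = b) {γ : AltForm V b} (hγ : γ ∈ S b) {U : MultiVec V p}
    (hU : U ∈ annihilator (S p)) : contract h γ U = 0 := by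
  induction m generalizing b with
  | zero =>
    obtain rfl : p = b := by omega
    ext w
    rw [contract_zero]
    exact hU γ hγ
  | succ m ih =>
    subst h
    ext w
    obtain ⟨s, hs⟩ := contract_cons γ
    have h0 := ih (fun a h₁ h₂ => hS a h₁ (by omega)) rfl
      (hS (p + m) (by omega) (by omega) γ hγ (w 0))
    have := hs U (w 0) (Fin.tail w)
    rw [Fin.cons_self_tail, h0] at this
    simpa using this

/-- `S^{∧ a}`: the span of all products `θ₁ ∧ ⋯ ∧ θₐ` of `1`-forms `θᵢ ∈ S`. -/
def wedgePower (S : Submodule ℝ (AltForm V 1)) (a : ℕ) : Submodule ℝ (AltForm V a) :=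
  Submodule.span ℝ {Θ | ∃ θ : Fin a → S, ∀ v : Fin a → V,
    Θ v = Matrix.det (Matrix.of fun i j => (θ i : AltForm V 1) ![v j])}

theorem contract_wedgePower_eq_zero (S : Submodule ℝ (AltForm V 1)) {m b : ℕ} (h : 1 + m = b)
    {Θ : AltForm V b} (hΘ : Θ ∈ wedgePower S b) {U : MultiVec V 1} (hU : U ∈ annihilator S) :
    contract h Θ U = 0 := by
  obtain ⟨u, rfl⟩ : ∃ u : Fin 1 → V, U = exteriorPower.ιMulti ℝ 1 u :=
    ⟨fun _ => exteriorPower.oneEquiv ℝ V U, by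
      apply (exteriorPower.oneEquiv ℝ V).injective; simp⟩
  induction hΘ using Submodule.span_induction with
  | mem Θ hΘ =>
    obtain ⟨θ, hθ⟩ := hΘ
    ext w
    rw [contract_ιMulti, hθ]
    let j : Fin b := finSumFinEquiv.trans (finCongr h) (Sum.inl 0)
    refine Matrix.det_eq_zero_of_column_eq_zero j fun i => ?_
    have h1 : joinArgs h u w j = u 0 := by
      simp [joinArgs, j]
    have h2 := hU (θ i) (θ i).2
    rw [pairing_ιMulti] at h2
    rw [Matrix.of_apply, h1]
    convert h2 using 2
    funext i; fin_cases i; rfl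
  | zero => simp
  | add a b _ _ ha hb => simp [ha, hb]
  | smul r a _ ha => simp [ha]

theorem pairing_surjective {p : ℕ} (g : AltForm V p →ₗ[ℝ] ℝ) :
    ∃ U : MultiVec V p, ∀ β, g β = pairing β U := by
  let φ : Module.Dual ℝ (MultiVec V p) →ₗ[ℝ] AltForm V p :=
    ofAlternating ∘ₗ exteriorPower.alternatingMapLinearEquiv.symm.toLinearMap
  obtain ⟨U, hU⟩ := (Module.evalEquiv ℝ (MultiVec V p)).surjective (g ∘ₗ φ)
  refine ⟨U, fun β => ?_⟩
  have h1 : φ (pairing β) = β := by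
    ext v
    change exteriorPower.alternatingMapLinearEquiv.symm
      (exteriorPower.alternatingMapLinearEquiv β.toAlternatingMap) v = _
    rw [LinearEquiv.symm_apply_apply]; rfl
  have := congrArg (fun f => f (pairing β)) hU
  simp only [LinearMap.comp_apply, h1] at this
  exact this.symm

instance (a : ℕ) : FiniteDimensional ℝ (AltForm V a) :=
  FiniteDimensional.of_injective (V₂ := Module.Dual ℝ (MultiVec V a)) pairing fun β β' h => by
    ext v
    rw [← pairing_ιMulti, ← pairing_ιMulti, h]

/-- The identity `𝟙ₚ ∈ ⋀ᵖ V* ⊗ ⋀ᵖ V`. -/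
def unitTensor (V : Type*) [NormedAddCommGroup V] [NormedSpace ℝ V] [FiniteDimensional ℝ V]
    (p : ℕ) : AltForm V p ⊗[ℝ] MultiVec V p :=
  TensorProduct.map
    (ofAlternating ∘ₗ exteriorPower.alternatingMapLinearEquiv.symm.toLinearMap) LinearMap.id
    (TensorProduct.comm ℝ (MultiVec V p) (Module.Dual ℝ (MultiVec V p))
      (coevaluation ℝ (MultiVec V p) 1))

/-- `γ` is `r`-horizontal with respect to the space `W` of vertical vectors: it vanishes as soon
as `a + 1 - r` of its `a` arguments are vertical. -/
def IsHorizontal (W : Submodule ℝ V) {a : ℕ} (r : ℕ) (γ : AltForm V a) : Prop :=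
  ∀ v : Fin a → V, (∃ s : Finset (Fin a), s.card + r = a + 1 ∧ ∀ i ∈ s, v i ∈ W) → γ v = 0

/-- The semi-basic `a`-forms with respect to the space `W` of vertical vectors. -/
def semiBasic (W : Submodule ℝ V) (a : ℕ) : Submodule ℝ (AltForm V a) where
  carrier := {γ | ∀ v : Fin a → V, (∃ i, v i ∈ W) → γ v = 0}
  add_mem' hγ hδ v hv := by simp [hγ v hv, hδ v hv]
  zero_mem' v _ := by simp
  smul_mem' r γ hγ v hv := by simp [hγ v hv]

end LinearAlgebra

section Calculus

variable {E : Type*} [NormedAddCommGroup E] [NormedSpace ℝ E] [FiniteDimensional ℝ E]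
  {M : Type*} [TopologicalSpace M] [ChartedSpace E M]
  {F : Type*} [NormedAddCommGroup F] [NormedSpace ℝ F] [FiniteDimensional ℝ F]
  {X : Type*} [TopologicalSpace X] [ChartedSpace F X]

/-! Throughout, `M` is modelled on `E`, and `TangentSpace 𝓘(ℝ, E) x` is by definition `E`. A field of
`a`-forms on `M` is a map `M → AltForm E a`, whose value at `x` is a form on the tangent space at `x`;
a field of `p`-vectors is a map `M → MultiVec E p`. -/

/-- The differential at `y` of the inverse of the preferred chart at `x`. -/
def chartSymmDeriv (x : M) (y : E) : E →L[ℝ] E :=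
  mfderiv 𝓘(ℝ, E) 𝓘(ℝ, E) (extChartAt 𝓘(ℝ, E) x).symm y

/-- The differential at `z` of the preferred chart at `x`. -/
def chartDeriv (x z : M) : E →L[ℝ] E :=
  mfderiv 𝓘(ℝ, E) 𝓘(ℝ, E) (extChartAt 𝓘(ℝ, E) x) z

/-- The expression of a field of forms in the preferred chart at `x`, that is, its pullback by the
inverse of the chart. -/
def chartRep {a : ℕ} (θ : M → AltForm E a) (x : M) (y : E) : AltForm E a :=
  (θ ((extChartAt 𝓘(ℝ, E) x).symm y)).compContinuousLinearMap (chartSymmDeriv x y)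

/-- Smoothness of a field of forms at a point. -/
def SmoothFormAt {a : ℕ} (θ : M → AltForm E a) (x : M) : Prop :=
  ContDiffAt ℝ ∞ (chartRep θ x) (extChartAt 𝓘(ℝ, E) x x)

/-- `θ ∈ Ωᵃ(M)`: `θ` is a smooth differential form. -/
def SmoothForm {a : ℕ} (θ : M → AltForm E a) : Prop := ∀ x, SmoothFormAt θ x

/-- Smoothness of a field of multivectors at a point: in the preferred chart, its coefficients
(its pairings with the constant forms of the model space) are smooth. -/
def SmoothMultiVecAt {p : ℕ} (U : M → MultiVec E p) (x : M) : Prop :=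
  ∀ c : AltForm E p, ContDiffAt ℝ ∞
    (fun y : E => pairing
      (c.compContinuousLinearMap (chartDeriv x ((extChartAt 𝓘(ℝ, E) x).symm y)))
      (U ((extChartAt 𝓘(ℝ, E) x).symm y)))
    (extChartAt 𝓘(ℝ, E) x x)

/-- `U ∈ 𝔛ᵖ(M)`: `U` is a smooth multivector field. -/
def SmoothMultiVec {p : ℕ} (U : M → MultiVec E p) : Prop := ∀ x, SmoothMultiVecAt U x

/-- The exterior derivative on `M`, computed at each point in the preferred chart. -/
def extD {a : ℕ} (θ : M → AltForm E a) (x : M) : AltForm E (a + 1) :=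
  (extDeriv (chartRep θ x) (extChartAt 𝓘(ℝ, E) x x)).compContinuousLinearMap
    (chartDeriv x x)

/-- `ι_U γ` for fields. -/
def contractField {p m b : ℕ} (h : p + m = b) (U : M → MultiVec E p) (γ : M → AltForm E b) :
    M → AltForm E m :=
  fun x => contract h (γ x) (U x)

/-- `α ∧ ε` for fields. -/
def wedgeField {a e : ℕ} (α : M → AltForm E a) (ε : M → AltForm E e) : M → AltForm E (a + e) :=
  fun x => wedge rfl (α x) (ε x)

/-- The Lie derivative `£_U γ = d ι_U γ - (-1)ᵖ ι_U d γ` of a `b`-form along a `p`-vector field,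
a form of degree `m = b + 1 - p`. For `m = 0` one has `b < p`, so that `ι_U γ = 0`. -/
def lieDeriv {p b : ℕ} (U : M → MultiVec E p) :
    (m : ℕ) → p + m = b + 1 → (M → AltForm E b) → (M → AltForm E m)
  | 0, h, γ => fun x => -((-1 : ℝ) ^ p • contractField h U (extD γ) x)
  | m + 1, h, γ => fun x =>
      extD (contractField (m := m) (by omega) U γ) x - (-1 : ℝ) ^ p • contractField h U (extD γ) x

/-- `W` is the Schouten-Nijenhuis bracket `[U, V]` of a `p`-vector field `U` and a `q`-vector field
`V`: the multivector field of degree `r = p + q - 1` such that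
`ι_{[U, V]} γ = (-1)^{(p - 1) q} £_U ι_V γ - ι_V £_U γ` for all smooth forms `γ`. -/
def IsSchoutenBracket {p q r : ℕ} (hp : 1 ≤ p) (hr : r + 1 = p + q)
    (U : M → MultiVec E p) (V : M → MultiVec E q) (W : M → MultiVec E r) : Prop :=
  SmoothMultiVec W ∧ ∀ (m : ℕ) (γ : M → AltForm E (r + m)), SmoothForm γ → ∀ x,
    contractField rfl W γ x =
      (-1 : ℝ) ^ ((p - 1) * q) •
          lieDeriv U m (by omega) (contractField (m := p - 1 + m) (by omega) V γ) x -
        contractField rfl V (lieDeriv U (q + m) (by omega) γ) x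

/-- `S` is a smooth vector subbundle of `⋀ᵃ M`: near each point it has a smooth local frame. -/
def IsSmoothSubbundle {a : ℕ} (S : M → Submodule ℝ (AltForm E a)) : Prop :=
  ∀ x₀ : M, ∃ (r : ℕ) (s : Fin r → M → AltForm E a), ∀ᶠ x in 𝓝 x₀,
    (∀ i, SmoothFormAt (s i) x) ∧ LinearIndependent ℝ (fun i => s i x) ∧
      Submodule.span ℝ (Set.range fun i => s i x) = S x

/-- `τ : M → X` is a fibered manifold: a smooth surjective submersion. -/
structure IsFiberedManifold (E F : Type*) [NormedAddCommGroup E] [NormedSpace ℝ E]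
    [NormedAddCommGroup F] [NormedSpace ℝ F] {M X : Type*} [TopologicalSpace M] [ChartedSpace E M]
    [TopologicalSpace X] [ChartedSpace F X] (τ : M → X) : Prop where
  smooth : ContMDiff 𝓘(ℝ, E) 𝓘(ℝ, F) ∞ τ
  surjective : Function.Surjective τ
  submersion : ∀ x, Function.Surjective (mfderiv 𝓘(ℝ, E) 𝓘(ℝ, F) τ x)

/-- The vertical vectors at `x`: the kernel of the differential of `τ`. -/
def vertical (F : Type*) [NormedAddCommGroup F] [NormedSpace ℝ F] {X : Type*}
    [TopologicalSpace X] [ChartedSpace F X] (τ : M → X) (x : M) : Submodule ℝ E :=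
  (mfderiv 𝓘(ℝ, E) 𝓘(ℝ, F) τ x : E →L[ℝ] F).toLinearMap.ker

/-- The vertical vectors at `x`, seen in `⋀¹ T_x M = T_x M`. -/
def verticalMultiVec (F : Type*) [NormedAddCommGroup F] [NormedSpace ℝ F] {X : Type*}
    [TopologicalSpace X] [ChartedSpace F X] (τ : M → X) (x : M) : Submodule ℝ (MultiVec E 1) :=
  (vertical F τ x).map (exteriorPower.oneEquiv ℝ E).symm.toLinearMap

/-- `τ^* β`. -/
def pullbackForm (τ : M → X) {a : ℕ} (β : X → AltForm F a) (x : M) : AltForm E a :=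
  (β (τ x)).compContinuousLinearMap (mfderiv 𝓘(ℝ, E) 𝓘(ℝ, F) τ x : E →L[ℝ] F)

/-- Basic forms: pullbacks of smooth forms on the base. -/
def IsBasic (F : Type*) [NormedAddCommGroup F] [NormedSpace ℝ F] {X : Type*}
    [TopologicalSpace X] [ChartedSpace F X] (τ : M → X) {a : ℕ} (ε : M → AltForm E a) : Prop :=
  ∃ β : X → AltForm F a, SmoothForm β ∧ ε = pullbackForm τ β

end Calculus

section Dirac

/-- A sequence of vector subbundles `Sᵃ ⊆ ⋀ᵃ M`, `1 ≤ a ≤ n`, related by contractions: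
`Sᵃ = ι_{TM} Sᵃ⁺¹`. The values of `S` in other degrees carry no meaning. -/
structure GradedSubbundle (E : Type*) [NormedAddCommGroup E] [NormedSpace ℝ E]
    [FiniteDimensional ℝ E] (M : Type*) [TopologicalSpace M] [ChartedSpace E M] (n : ℕ) where
  one_le : 1 ≤ n
  S : ∀ (a : ℕ), M → Submodule ℝ (AltForm E a)
  subbundle : ∀ a, 1 ≤ a → a ≤ n → IsSmoothSubbundle (S a)
  contraction : ∀ a, 1 ≤ a → a < n → ∀ x,
    S a x = Submodule.span ℝ {β | ∃ v : E, ∃ α ∈ S (a + 1) x, β = α.curryLeft v}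

variable {E : Type*} [NormedAddCommGroup E] [NormedSpace ℝ E] [FiniteDimensional ℝ E]
  {M : Type*} [TopologicalSpace M] [ChartedSpace E M]
  {n : ℕ}

namespace GradedSubbundle

variable (B : GradedSubbundle E M n)

/-- `Kₚ = {U ∈ ⋁ₚ M : ι_U Sᵖ = 0}`. -/
abbrev K (p : ℕ) (x : M) : Submodule ℝ (MultiVec E p) := annihilator (B.S p x)

/-- The fibre of `⋁ₚ M / Kₚ`. -/
abbrev Q (p : ℕ) (x : M) : Type _ := MultiVec E p ⧸ B.K p x

theorem contract_eq_zero {p m b : ℕ} (hp : 1 ≤ p) (hb : b ≤ n) (h : p + m = b) {x : M}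
    {γ : AltForm E b} (hγ : γ ∈ B.S b x) {U : MultiVec E p} (hU : U ∈ B.K p x) :
    contract h γ U = 0 := by
  refine GradedDirac.contract_eq_zero (fun a => B.S a x) (fun a h₁ h₂ α hα v => ?_) h hγ hU
  change _ ∈ B.S a x
  rw [B.contraction a (by omega) (by omega) x]
  exact Submodule.subset_span ⟨v, α, hα, rfl⟩

/-- The contraction `ι_u γ` of `γ ∈ Sᵇ`, `b ≤ n`, by a class `u ∈ ⋁ₚ M / Kₚ`. -/
def contractQ {p m b : ℕ} (hp : 1 ≤ p) (hb : b ≤ n) (h : p + m = b) (x : M)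
    (γ : AltForm E b) (hγ : γ ∈ B.S b x) : B.Q p x →ₗ[ℝ] AltForm E m :=
  (B.K p x).liftQ (contract h γ) fun _ hU =>
    LinearMap.mem_ker.mpr (B.contract_eq_zero hp hb h hγ hU)

/-- The contraction of `γ ∈ Sᵇ`, `b ≤ n`, by an element of `⋀ᵏ M ⊗ ⋁ₚ M / Kₚ`, given by
`ι_{θ ⊗ u} γ = θ ∧ ι_u γ`. -/
def contractT {k p m b c : ℕ} (hp : 1 ≤ p) (hb : b ≤ n) (h : p + m = b) (hc : k + m = c) (x : M)
    (γ : AltForm E b) (hγ : γ ∈ B.S b x) : AltForm E k ⊗[ℝ] B.Q p x →ₗ[ℝ] AltForm E c :=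
  TensorProduct.lift ((wedge hc).compl₂ (B.contractQ hp hb h x γ hγ))

/-- The contraction `ι_u Θ` of `Θ ∈ (S¹)^{∧ (c + 1)}` by a class `u ∈ TM / K₁`. -/
def contractPower {c : ℕ} (x : M) (Θ : AltForm E (c + 1))
    (hΘ : Θ ∈ wedgePower (B.S 1 x) (c + 1)) : B.Q 1 x →ₗ[ℝ] AltForm E c :=
  (B.K 1 x).liftQ (contract (Nat.add_comm 1 c) Θ) fun _ hU =>
    LinearMap.mem_ker.mpr (contract_wedgePower_eq_zero _ _ hΘ hU)

/-- Dualization: every linear map `Sⁿ → ⋀ᶜ M` is the contraction with an element of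
`⋀ᶜ M ⊗ ⋁ₙ M / Kₙ`. -/
theorem exists_contractT_eq {c : ℕ} (x : M) (f : B.S n x →ₗ[ℝ] AltForm E c) :
    ∃ T : AltForm E c ⊗[ℝ] B.Q n x, ∀ (α : AltForm E n) (hα : α ∈ B.S n x),
      B.contractT B.one_le le_rfl (Nat.add_zero n) (Nat.add_zero c) x α hα T = f ⟨α, hα⟩ := by
  have : Module.Free ℝ (B.S n x) := Module.Free.of_divisionRing ℝ (B.S n x)
  have : Module.Finite ℝ (B.S n x) := inferInstance
  let b := Module.finBasis ℝ (B.S n x)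
  have h1 : ∀ i, ∃ U : MultiVec E n, ∀ α : B.S n x, b.repr α i = pairing (α : AltForm E n) U := by
    intro i
    obtain ⟨g, hg⟩ := LinearMap.exists_extend (b.coord i)
    obtain ⟨U, hU⟩ := pairing_surjective g
    refine ⟨U, fun α => ?_⟩
    rw [← hU, ← Module.Basis.coord_apply, ← hg]
    rfl
  choose U hU using h1
  refine ⟨∑ i, f (b i) ⊗ₜ (Submodule.Quotient.mk (U i)), fun α hα => ?_⟩
  have h2 : ∀ i, B.contractT B.one_le le_rfl (Nat.add_zero n) (Nat.add_zero c) x α hα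
      (f (b i) ⊗ₜ (Submodule.Quotient.mk (U i))) = b.repr ⟨α, hα⟩ i • f (b i) := by
    intro i
    have : B.contractT B.one_le le_rfl (Nat.add_zero n) (Nat.add_zero c) x α hα
        (f (b i) ⊗ₜ (Submodule.Quotient.mk (U i))) =
        wedge (Nat.add_zero c) (f (b i)) (contract (Nat.add_zero n) α (U i)) := rfl
    rw [this, wedge_zero_form, contract_zero, hU]
  rw [map_sum, Finset.sum_congr rfl fun i _ => h2 i]
  conv_rhs => rw [← b.sum_repr ⟨α, hα⟩, map_sum]
  simp only [map_smul]

end GradedSubbundle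

/-- A regular graded Dirac structure of order `n` on `M`: subbundles `Sᵃ` related by contractions
and vector bundle maps `♯ₐ : Sᵃ → ⋁ₚ M / Kₚ`, `p = n + 1 - a`, `1 ≤ a ≤ n`, that are skew-symmetric
and integrable. The degrees `a`, `p` with `a + p = n + 1` are both recorded in `sharp`; its values
for `a = 0` or `p = 0` carry no meaning. -/
structure GradedDiracStructure (E : Type*) [NormedAddCommGroup E] [NormedSpace ℝ E]
    [FiniteDimensional ℝ E] (M : Type*) [TopologicalSpace M] [ChartedSpace E M] (n : ℕ)
    extends GradedSubbundle E M n where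
  sharp : ∀ (a p : ℕ), a + p = n + 1 → ∀ x : M, S a x →ₗ[ℝ] toGradedSubbundle.Q p x
  /-- `♯ₐ` is smooth: smooth local sections go to sections with smooth local lifts. -/
  sharp_smooth : ∀ (a p : ℕ) (h : a + p = n + 1), 1 ≤ a → 1 ≤ p →
    ∀ (x₀ : M) (α : M → AltForm E a), (∀ᶠ x in 𝓝 x₀, SmoothFormAt α x ∧ α x ∈ S a x) →
      ∃ U : M → MultiVec E p, ∀ᶠ x in 𝓝 x₀, SmoothMultiVecAt U x ∧
        ∀ hx : α x ∈ S a x, sharp a p h x ⟨α x, hx⟩ = Submodule.Quotient.mk (U x)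
  /-- `ι_{♯ₐ(α)} β = (-1)^{pq} ι_{♯_b(β)} α`. Both sides are zero unless `a + b ≥ n + 1`. -/
  skew : ∀ (a p b q m : ℕ) (ha : a + p = n + 1) (hb : b + q = n + 1) (ha' : a ≤ n) (hb' : b ≤ n)
    (hp : 1 ≤ p) (hq : 1 ≤ q) (h₁ : p + m = b) (h₂ : q + m = a) (x : M)
    (α : S a x) (β : S b x),
    toGradedSubbundle.contractQ hp hb' h₁ x β β.2 (sharp a p ha x α) =
      (-1 : ℝ) ^ (p * q) • toGradedSubbundle.contractQ hq ha' h₂ x α α.2 (sharp b q hb x β)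
  /-- For sections `α`, `β` of `Sᵃ`, `S^b` with `♯ₐ(α) = U + Kₚ`, `♯_b(β) = V + K_q`, the form
  `θ = (-1)^{(p-1)q} £_U β + (-1)^q £_V α - (-1)^q / 2 d (ι_V α + (-1)^{pq} ι_U β)`, of degree
  `c + 1 = a + b - n`, is a section of `S^{a+b-n}`, and `♯_{a+b-n}(θ) = [U, V] + K_{p+q-1}`. -/
  integrable : ∀ (a p b q c r : ℕ) (_ : a + p = n + 1) (_ : b + q = n + 1) (_ : a ≤ n) (_ : b ≤ n)
    (hp : 1 ≤ p) (_ : 1 ≤ q) (h₁ : p + c = b) (h₂ : q + c = a) (hr : r + 1 = p + q)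
    (hc : (c + 1) + r = n + 1)
    (α : M → AltForm E a) (β : M → AltForm E b) (U : M → MultiVec E p) (V : M → MultiVec E q),
    SmoothForm α → SmoothForm β → SmoothMultiVec U → SmoothMultiVec V →
    (∀ x, ∃ hx : α x ∈ S a x, sharp a p ‹_› x ⟨α x, hx⟩ = Submodule.Quotient.mk (U x)) →
    (∀ x, ∃ hx : β x ∈ S b x, sharp b q ‹_› x ⟨β x, hx⟩ = Submodule.Quotient.mk (V x)) →
    ∃ W : M → MultiVec E r, IsSchoutenBracket hp hr U V W ∧
      ∀ x, ∃ hx : (-1 : ℝ) ^ ((p - 1) * q) • lieDeriv U (c + 1) (by omega) β x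
            + (-1 : ℝ) ^ q • lieDeriv V (c + 1) (by omega) α x
            - ((-1 : ℝ) ^ q / 2) • extD (fun y => contractField h₂ V α y
                + (-1 : ℝ) ^ (p * q) • contractField h₁ U β y) x ∈ S (c + 1) x,
        sharp (c + 1) r hc x ⟨_, hx⟩ = Submodule.Quotient.mk (W x)

namespace GradedDiracStructure

variable (D : GradedDiracStructure E M n)

/-- `D` is fibered over the base of `τ : M → X`, where `dim X = n`: `Sᵃ` consists of
`(a - 1)`-horizontal forms and contains every semi-basic `a`-form. -/
structure IsFibered (F : Type*) [NormedAddCommGroup F] [NormedSpace ℝ F] {X : Type*}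
    [TopologicalSpace X] [ChartedSpace F X] (τ : M → X) : Prop where
  isFiberedManifold : IsFiberedManifold E F τ
  finrank_base : Module.finrank ℝ F = n
  horizontal : ∀ a, 1 ≤ a → a ≤ n → ∀ x, ∀ γ ∈ D.S a x, IsHorizontal (vertical F τ x) (a - 1) γ
  semiBasic_le : ∀ a, 1 ≤ a → a ≤ n → ∀ x, semiBasic (vertical F τ x) a ≤ D.S a x

/-- `α ∈ Ω_Hᵃ(M)`: `0 ≤ a ≤ n - 1`, and `dα` takes values in `Sᵃ⁺¹`. -/
structure IsHamiltonianForm {a : ℕ} (α : M → AltForm E a) : Prop where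
  degree_lt : a + 1 ≤ n
  smooth : SmoothForm α
  mem : ∀ x, extD α x ∈ D.S (a + 1) x

/-- `α` is special Hamiltonian: `α` is a Hamiltonian form, and `α ∧ ε ∈ Ω_H^{n-1}(M)` for every
closed basic form `ε` of degree `e = n - 1 - a`. -/
structure IsSpecialHamiltonian (F : Type*) [NormedAddCommGroup F] [NormedSpace ℝ F] {X : Type*}
    [TopologicalSpace X] [ChartedSpace F X] (τ : M → X) {a : ℕ} (α : M → AltForm E a) : Prop where
  isHamiltonianForm : D.IsHamiltonianForm α
  wedge_mem : ∀ (e : ℕ), a + e = n - 1 → ∀ ε : M → AltForm E e, IsBasic F τ ε →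
    (∀ x, extD ε x = 0) → D.IsHamiltonianForm (wedgeField α ε)

theorem exists_sharpOne {c : ℕ} (x : M) (Θ : AltForm E (c + 1))
    (hΘ : Θ ∈ wedgePower (D.S 1 x) (c + 1)) :
    ∃ T : AltForm E c ⊗[ℝ] D.Q n x, ∀ (α : AltForm E n) (hα : α ∈ D.S n x),
      D.contractPower x Θ hΘ (D.sharp n 1 rfl x ⟨α, hα⟩) =
        (-1 : ℝ) ^ ((n : ℤ) + 1 - (c + 1)) •
          D.contractT D.one_le le_rfl (Nat.add_zero n) (Nat.add_zero c) x α hα T := by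
  obtain ⟨T, hT⟩ := D.exists_contractT_eq x
    ((-1 : ℝ) ^ ((n : ℤ) + 1 - (c + 1)) • (D.contractPower x Θ hΘ ∘ₗ D.sharp n 1 rfl x))
  refine ⟨T, fun α hα => ?_⟩
  rw [hT α hα, LinearMap.smul_apply, smul_smul, ← mul_zpow]
  simp

/-- The canonical extension `♯̃₁ : (S¹)^{∧ (c + 1)} → ⋀ᶜ M ⊗ ⋁ₙ M / Kₙ`: the element `♯̃₁(Θ)` is
determined by `ι_{♯ₙ(α)} Θ = (-1)^{n + 1 - (c + 1)} ι_{♯̃₁(Θ)} α` for all `α ∈ Sⁿ`. -/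
def sharpOne {c : ℕ} (x : M) (Θ : AltForm E (c + 1))
    (hΘ : Θ ∈ wedgePower (D.S 1 x) (c + 1)) : AltForm E c ⊗[ℝ] D.Q n x :=
  (D.exists_sharpOne x Θ hΘ).choose

theorem sharpOne_spec {c : ℕ} (x : M) (Θ : AltForm E (c + 1))
    (hΘ : Θ ∈ wedgePower (D.S 1 x) (c + 1)) (α : AltForm E n) (hα : α ∈ D.S n x) :
    D.contractPower x Θ hΘ (D.sharp n 1 rfl x ⟨α, hα⟩) =
      (-1 : ℝ) ^ ((n : ℤ) + 1 - (c + 1)) •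
        D.contractT D.one_le le_rfl (Nat.add_zero n) (Nat.add_zero c) x α hα
          (D.sharpOne x Θ hΘ) :=
  (D.exists_sharpOne x Θ hΘ).choose_spec α hα

theorem sub_one_add (D : GradedDiracStructure E M n) : 1 + (n - 1) = n := by
  have := D.one_le
  omega

theorem add_sub_one (D : GradedDiracStructure E M n) {k c : ℕ} (h : k + n = c + 1) : k + (n - 1) = c := by
  have := D.one_le
  omega

/-- `T ∈ ⋀ᵏ M ⊗ TM / K₁` is a possible value of `♯̃ₙ` at `Θ ∈ (S¹)^{∧ (c + 1)}`, `c + 1 = n + k`: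
`ι_T α = ι_{♯̃₁(Θ)} α` for all `α ∈ Sⁿ`. -/
def IsSharpValue {k c : ℕ} (h : k + n = c + 1) (x : M) (Θ : AltForm E (c + 1))
    (hΘ : Θ ∈ wedgePower (D.S 1 x) (c + 1)) (T : AltForm E k ⊗[ℝ] D.Q 1 x) : Prop :=
  ∀ (α : AltForm E n) (hα : α ∈ D.S n x),
    D.contractT le_rfl le_rfl D.sub_one_add (D.add_sub_one h) x α hα T =
      D.contractT D.one_le le_rfl (Nat.add_zero n) (Nat.add_zero c) x α hα (D.sharpOne x Θ hΘ)

theorem isSharpValue_iff {k c : ℕ} (h : k + n = c + 1) (x : M) (Θ : AltForm E (c + 1))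
    (hΘ : Θ ∈ wedgePower (D.S 1 x) (c + 1)) (T : AltForm E k ⊗[ℝ] D.Q 1 x) :
    D.IsSharpValue h x Θ hΘ T ↔ ∀ (α : AltForm E n) (hα : α ∈ D.S n x),
      D.contractPower x Θ hΘ (D.sharp n 1 rfl x ⟨α, hα⟩) =
        (-1 : ℝ) ^ ((n : ℤ) + 1 - (c + 1)) •
          D.contractT le_rfl le_rfl D.sub_one_add (D.add_sub_one h) x α hα T := by
  have hz : (-1 : ℝ) ^ ((n : ℤ) + 1 - (c + 1)) ≠ 0 := zpow_ne_zero _ (by norm_num)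
  refine forall₂_congr fun α hα => ?_
  rw [D.sharpOne_spec x Θ hΘ α hα]
  constructor
  · intro h; rw [h]
  · intro h; exact (smul_right_injective _ hz h).symm

/-- The fibre of `Sᵃ[n]`, `a = c + 1 = n + k`: the forms in `(S¹)^{∧ a}` at which a value of `♯̃ₙ`
compatible with `♯̃₁` exists. -/
def extDomain {k c : ℕ} (h : k + n = c + 1) (x : M) : Submodule ℝ (AltForm E (c + 1)) where
  carrier := {Θ | ∃ (hΘ : Θ ∈ wedgePower (D.S 1 x) (c + 1)) (T : AltForm E k ⊗[ℝ] D.Q 1 x),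
    D.IsSharpValue h x Θ hΘ T}
  add_mem' := by
    rintro Θ Θ' ⟨hΘ, T, hT⟩ ⟨hΘ', T', hT'⟩
    refine ⟨Submodule.add_mem _ hΘ hΘ', T + T', ?_⟩
    rw [isSharpValue_iff] at hT hT' ⊢
    intro α hα
    rw [map_add, smul_add, ← hT α hα, ← hT' α hα]
    obtain ⟨U, hU⟩ := Submodule.Quotient.mk_surjective _ (D.sharp n 1 rfl x ⟨α, hα⟩)
    rw [← hU]
    change contract _ (Θ + Θ') U = contract _ Θ U + contract _ Θ' U
    simp
  zero_mem' := by
    refine ⟨Submodule.zero_mem _, 0, ?_⟩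
    rw [isSharpValue_iff]
    intro α hα
    obtain ⟨U, hU⟩ := Submodule.Quotient.mk_surjective _ (D.sharp n 1 rfl x ⟨α, hα⟩)
    rw [← hU, map_zero, smul_zero]
    change contract _ (0 : AltForm E (c + 1)) U = 0
    simp
  smul_mem' := by
    rintro r Θ ⟨hΘ, T, hT⟩
    refine ⟨Submodule.smul_mem _ r hΘ, r • T, ?_⟩
    rw [isSharpValue_iff] at hT ⊢
    intro α hα
    rw [map_smul, smul_comm, ← hT α hα]
    obtain ⟨U, hU⟩ := Submodule.Quotient.mk_surjective _ (D.sharp n 1 rfl x ⟨α, hα⟩)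
    rw [← hU]
    change contract _ (r • Θ) U = r • contract _ Θ U
    simp

/-- An extension `♯̃ₙ : Sᵃ[n] → ⋀ᵏ M ⊗ TM / K₁`, `a = c + 1 = n + k`: a smooth vector bundle map with
`ι_{♯̃ₙ(Θ)} α = ι_{♯̃₁(Θ)} α` for all `α ∈ Sⁿ`. Smoothness means that smooth local sections go to
sections that are locally finite sums of products of smooth forms and smooth vector fields. -/
structure SharpExtension {k c : ℕ} (h : k + n = c + 1) where
  toFun : ∀ x, D.extDomain h x →ₗ[ℝ] AltForm E k ⊗[ℝ] D.Q 1 x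
  isSharpValue : ∀ x (Θ : D.extDomain h x), D.IsSharpValue h x Θ Θ.2.choose (toFun x Θ)
  smooth : ∀ (x₀ : M) (Θ : M → AltForm E (c + 1)),
    (∀ᶠ x in 𝓝 x₀, SmoothFormAt Θ x ∧ Θ x ∈ D.extDomain h x) →
      ∃ (N : ℕ) (θ : Fin N → M → AltForm E k) (U : Fin N → M → MultiVec E 1),
        ∀ᶠ x in 𝓝 x₀, (∀ i, SmoothFormAt (θ i) x ∧ SmoothMultiVecAt (U i) x) ∧
          ∀ hx : Θ x ∈ D.extDomain h x,
            toFun x ⟨Θ x, hx⟩ = ∑ i, θ i x ⊗ₜ[ℝ] Submodule.Quotient.mk (U i x)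

/-- `♯̃ₙ` takes vertical values, i.e. values in the image of `⋀ᵏ M ⊗ ker dτ` in `⋀ᵏ M ⊗ TM / K₁`. -/
def SharpExtension.IsVerticalValued {D : GradedDiracStructure E M n} {k c : ℕ}
    {h : k + n = c + 1} (s : D.SharpExtension h)
    (F : Type*) [NormedAddCommGroup F] [NormedSpace ℝ F] {X : Type*}
    [TopologicalSpace X] [ChartedSpace F X] (τ : M → X) : Prop :=
  ∀ x (Θ : D.extDomain h x), s.toFun x Θ ∈
    LinearMap.range (TensorProduct.map (LinearMap.id : AltForm E k →ₗ[ℝ] AltForm E k)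
      ((D.K 1 x).mkQ ∘ₗ (verticalMultiVec F τ x).subtype))

/-- The bracket `{α, Θ}_{♯̃ₙ} = (-1)^{deg_H Θ} ι_{♯̃ₙ(dΘ)} dα` of a Hamiltonian `a`-form `α` and a
`c`-form `Θ`, `c ≥ n`, such that `dΘ` takes values in `S^{c+1}[n]`; here
`deg_H Θ = n - 1 - c`. -/
def bracket {k c : ℕ} {h : k + n = c + 1} (s : D.SharpExtension h) {a : ℕ}
    (α : M → AltForm E a) (hα : D.IsHamiltonianForm α) (Θ : M → AltForm E c)
    (hΘ : ∀ x, extD Θ x ∈ D.extDomain h x) : M → AltForm E (k + a) :=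
  fun x => (-1 : ℝ) ^ ((n : ℤ) - 1 - c) •
    D.contractT le_rfl hα.degree_lt (Nat.add_comm 1 a) rfl x (extD α x) (hα.mem x)
      (s.toFun x ⟨extD Θ x, hΘ x⟩)

/-- The element `-♯̃₁(Θ) + 𝟙ₙ` of `⋀ⁿ M ⊗ ⋁ₙ M / Kₙ`, for `Θ ∈ (S¹)^{∧ (n + 1)}`. -/
def evolutionTensor (x : M) (Θ : AltForm E (n + 1))
    (hΘ : Θ ∈ wedgePower (D.S 1 x) (n + 1)) : AltForm E n ⊗[ℝ] D.Q n x :=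
  -D.sharpOne x Θ hΘ + TensorProduct.map LinearMap.id (D.K n x).mkQ (unitTensor E n)

/-- `H` is a Hamiltonian: a smooth `n`-form with `dH ∈ S^{n+1}[n]` such that `-♯̃₁(dH) + 𝟙ₙ` is a
semi-basic form (with values in `⋁ₙ M / Kₙ`) and `ι_{-♯̃₁(dH) + 𝟙ₙ} γ = γ` for every semi-basic
`n`-form `γ`. (On a fibered structure, all semi-basic `n`-forms belong to `Sⁿ`.) -/
structure IsHamiltonian (F : Type*) [NormedAddCommGroup F] [NormedSpace ℝ F] {X : Type*}
    [TopologicalSpace X] [ChartedSpace F X] (τ : M → X) (H : M → AltForm E n) : Prop where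
  smooth : SmoothForm H
  mem : ∀ x, extD H x ∈ D.extDomain (Nat.add_comm 1 n) x
  semiBasic : ∀ x, D.evolutionTensor x (extD H x) (mem x).choose ∈
    LinearMap.range (TensorProduct.map (semiBasic (vertical F τ x) n).subtype
      (LinearMap.id : D.Q n x →ₗ[ℝ] D.Q n x))
  contract_eq : ∀ x, ∀ γ ∈ GradedDirac.semiBasic (vertical F τ x) n, ∀ hγ : γ ∈ D.S n x,
    D.contractT D.one_le le_rfl (Nat.add_zero n) (Nat.add_zero n) x γ hγ
      (D.evolutionTensor x (extD H x) (mem x).choose) = γ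

end GradedDiracStructure

end Dirac

end GradedDirac

end

/-! Fix `x` and let δ be the difference of the two contractions of `dα` at `x`, a form of degree `a
+ 1`. Put `e = n - 1 - a`. For a closed basic `e`-form ε, the form `α ∧ ε` is Hamiltonian of degree
`n - 1`, so `d(α ∧ ε) = dα ∧ ε` lies in `Sⁿ`. There all extensions contract alike, since they all
agree with `♯̃₁`. Vertical vectors annihilate ε, so contraction with a vertical-valued tensor
commutes with `∧ ε` (`GradedSubbundle.contractT_wedge_decomposable`). Hence `δ ∧ ε = 0` at `x`.

There are enough such ε to force `δ = 0`. Given `v₁, …, v_{a+1}`, the dimension `n = (a + 1) + e` of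
the base leaves room for `e` independent covectors on the base that vanish on the images of all `vᵢ`
(`exists_decomposable_ne_zero`). Let ε have their product as its value at `x`. Inserting the `vᵢ`
into `δ ∧ ε = 0` leaves `δ(v₁, …, v_{a+1}) ε = 0` (`apply_smul_decomposable_eq_zero`) with `ε ≠ 0`
at `x`. No horizontality of δ is needed.

A global closed ε with prescribed value comes from a cut-off chart `f : X → F`
(`exists_contMDiff_surjective_mfderiv`): the pullback of a constant form by `f ∘ τ` is smooth,
closed and basic on all of `M`.

The exterior algebra is reduced by linearity to products of covectors, where the wedge product is
concatenation of lists and evaluation is a determinant. -/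

noncomputable section

namespace GradedDirac

/-! ### Exterior algebra on products of covectors. -/

section Decomposable

variable {V : Type*} [NormedAddCommGroup V] [NormedSpace ℝ V] [FiniteDimensional ℝ V]

/-- The multilinear map `v ↦ ∏ i, l i (v i)`. -/
def prodMultilinear {ι : Type*} [Fintype ι] (l : ι → V →L[ℝ] ℝ) :
    MultilinearMap ℝ (fun _ : ι => V) ℝ :=
  (MultilinearMap.mkPiAlgebra ℝ ι ℝ).compLinearMap fun i => (l i).toLinearMap

@[simp] theorem prodMultilinear_apply {ι : Type*} [Fintype ι] (l : ι → V →L[ℝ] ℝ) (v : ι → V) :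
    prodMultilinear l v = ∏ i, l i (v i) := rfl

/-- The decomposable form `l₁ ∧ ⋯ ∧ lₐ`. -/
def decomposable {a : ℕ} (l : Fin a → V →L[ℝ] ℝ) : AltForm V a :=
  ofAlternating (MultilinearMap.alternatization (prodMultilinear l))

theorem decomposable_apply {a : ℕ} (l : Fin a → V →L[ℝ] ℝ) (v : Fin a → V) :
    decomposable l v = Matrix.det (Matrix.of fun i j => l i (v j)) := by
  rw [← Matrix.det_transpose, Matrix.det_apply]
  simp [decomposable, MultilinearMap.alternatization_apply]

/-- In a basis, an alternating map is, as a multilinear map, a combination of products of coordinate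
functionals. Alternatizing turns the products into decomposable forms and multiplies the alternating
map by `a!`, which is invertible. -/
theorem span_decomposable (a : ℕ) :
    Submodule.span ℝ (Set.range (decomposable (V := V) (a := a))) = ⊤ := by
  rw [eq_top_iff]
  intro γ _
  let b := Module.finBasis ℝ V
  let c : Fin (Module.finrank ℝ V) → V →L[ℝ] ℝ := fun j => LinearMap.toContinuousLinearMap (b.coord j)
  have h1 : (γ.toAlternatingMap : MultilinearMap ℝ (fun _ : Fin a => V) ℝ) =
      ∑ r : Fin a → Fin (Module.finrank ℝ V),
        γ (fun i => b (r i)) • prodMultilinear (fun i => c (r i)) := by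
    refine Module.Basis.ext_multilinear (fun _ => b) fun r => ?_
    rw [_root_.sum_apply, Finset.sum_eq_single r]
    · simp [c, Module.Basis.coord_apply]
    · intro s _ hs
      obtain ⟨i, hi⟩ := Function.ne_iff.mp hs
      rw [_root_.smul_apply, prodMultilinear_apply,
        Finset.prod_eq_zero (Finset.mem_univ i), smul_zero]
      simp [c, Module.Basis.coord_apply, hi.symm]
    · simp
  have hsmul : ∀ (r : ℝ) (m : MultilinearMap ℝ (fun _ : Fin a => V) ℝ),
      MultilinearMap.alternatization (r • m) = r • MultilinearMap.alternatization m := by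
    intro r m
    ext v
    simp [MultilinearMap.alternatization_apply, Finset.mul_sum, Units.smul_def, mul_left_comm]
  have h2 := congrArg (fun m => ofAlternating (MultilinearMap.alternatization m)) h1
  simp only [map_sum, hsmul, map_smul] at h2
  have h3 : ofAlternating (MultilinearMap.alternatization γ.toMultilinearMap) =
      (Fintype.card (Fin a)).factorial • γ := by
    change ofAlternating (MultilinearMap.alternatization
      (γ.toAlternatingMap : MultilinearMap ℝ (fun _ : Fin a => V) ℝ)) = _
    rw [AlternatingMap.coe_alternatization, map_nsmul]
    rfl
  rw [h3] at h2
  have h4 : γ = ((Fintype.card (Fin a)).factorial : ℝ)⁻¹ •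
      ((Fintype.card (Fin a)).factorial • γ) := by
    rw [← Nat.cast_smul_eq_nsmul ℝ, inv_smul_smul₀]
    exact_mod_cast Nat.factorial_ne_zero _
  rw [h4, h2]
  exact Submodule.smul_mem _ _ (Submodule.sum_mem _ fun r _ =>
    Submodule.smul_mem _ _ (Submodule.subset_span ⟨_, rfl⟩))

-- Lets identities that are linear in a form be checked on products of covectors. The case of zero
-- is `0 • decomposable l`.
@[elab_as_elim]
theorem decomposable_induction {a : ℕ} {P : AltForm V a → Prop}
    (mem : ∀ l, P (decomposable l)) (add : ∀ γ δ, P γ → P δ → P (γ + δ))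
    (smul : ∀ (r : ℝ) γ, P γ → P (r • γ)) (γ : AltForm V a) : P γ := by
  have h : γ ∈ Submodule.span ℝ (Set.range (decomposable (V := V) (a := a))) := by
    rw [span_decomposable]; trivial
  induction h using Submodule.span_induction with
  | mem x hx => obtain ⟨l, rfl⟩ := hx; exact mem l
  | zero => simpa using smul 0 _ (mem 0)
  | add x y _ _ hx hy => exact add x y hx hy
  | smul r x _ hx => exact smul r x hx

/-- The shuffle sum of two alternatizations is the alternatization of the product over all
permutations, with no factorial; this is the Leibniz expansion of the determinant of the
concatenated list. -/
theorem wedge_decomposable {a b c : ℕ} (h : a + b = c) (l : Fin a → V →L[ℝ] ℝ)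
    (m : Fin b → V →L[ℝ] ℝ) :
    wedge h (decomposable l) (decomposable m) = decomposable (joinArgs h l m) := by
  ext v
  let e := finSumFinEquiv.trans (finCongr h)
  change LinearMap.mul' ℝ ℝ (((MultilinearMap.alternatization (prodMultilinear l)).domCoprod
    (MultilinearMap.alternatization (prodMultilinear m))) (v ∘ e)) = _
  rw [← MultilinearMap.domCoprod_alternization, MultilinearMap.alternatization_apply, map_sum,
    decomposable_apply, ← Matrix.det_transpose, ← Matrix.det_submatrix_equiv_self e,
    Matrix.det_apply]
  refine Finset.sum_congr rfl fun σ _ => ?_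
  refine (map_zsmul (LinearMap.mul' ℝ ℝ) ((Equiv.Perm.sign σ : ℤˣ) : ℤ) _).trans ?_
  simp only [Units.smul_def, Fintype.prod_sum_type]
  congr 1
  simp [joinArgs, e, MultilinearMap.domCoprod_apply]

/-- Reduces equalities between concatenated lists to comparisons of indices in `ℕ`. -/
theorem joinArgs_apply {p m b : ℕ} (h : p + m = b) (u : Fin p → V) (w : Fin m → V) (k : Fin b) :
    joinArgs h u w k = if hk : (k : ℕ) < p then u ⟨k, hk⟩ else w ⟨k - p, by omega⟩ := by
  obtain ⟨s, rfl⟩ := (finSumFinEquiv.trans (finCongr h)).surjective k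
  have : joinArgs h u w ((finSumFinEquiv.trans (finCongr h)) s) = Sum.elim u w s := by
    simp only [joinArgs, Function.comp_apply, Equiv.symm_apply_apply]
  rw [this]
  rcases s with i | i <;> simp

/-- On decomposable forms this is associativity of concatenation. Naming every degree separately
avoids casts between forms of equal degree. -/
theorem wedge_assoc {a b c ab bc abc : ℕ} (h₁ : a + b = ab) (h₂ : ab + c = abc) (h₃ : b + c = bc)
    (h₄ : a + bc = abc) (α : AltForm V a) (β : AltForm V b) (γ : AltForm V c) :
    wedge h₂ (wedge h₁ α β) γ = wedge h₄ α (wedge h₃ β γ) := by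
  induction α using decomposable_induction with
  | add x y hx hy => simp [hx, hy]
  | smul r x hx => simp [hx]
  | mem l =>
  induction β using decomposable_induction with
  | add x y hx hy => simp [hx, hy]
  | smul r x hx => simp [hx]
  | mem m =>
  induction γ using decomposable_induction with
  | add x y hx hy => simp [hx, hy]
  | smul r x hx => simp [hx]
  | mem n =>
  simp only [wedge_decomposable]
  congr 1
  funext k
  simp only [joinArgs_apply]
  split_ifs <;> first | omega | rfl | (congr 1; apply Fin.ext; dsimp; omega)

theorem zero_form_wedge {c : ℕ} (h : 0 + c = c) (θ : AltForm V 0) (η : AltForm V c) :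
    wedge h θ η = θ 0 • η := by
  induction θ using decomposable_induction with
  | add x y hx hy => simp [hx, hy, add_smul]
  | smul r x hx => simp [hx, mul_smul]
  | mem l =>
  induction η using decomposable_induction with
  | add x y hx hy => simp [hx, hy]
  | smul r x hx => rw [map_smul, hx, smul_comm]
  | mem m =>
  rw [wedge_decomposable, decomposable_apply, Matrix.det_isEmpty, one_smul]
  congr 1
  funext k
  simp [joinArgs_apply]

/-- Laplace expansion along the first column, which holds the values of the covectors at `v`. -/
theorem decomposable_curryLeft {a : ℕ} (l : Fin (a + 1) → V →L[ℝ] ℝ) (v : V) :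
    (decomposable l).curryLeft v =
      ∑ i : Fin (a + 1), ((-1) ^ (i : ℕ) * l i v) • decomposable (l ∘ i.succAbove) := by
  ext w
  change decomposable l (Matrix.vecCons v w) = _
  rw [decomposable_apply, Matrix.det_succ_column_zero, ContinuousAlternatingMap.sum_apply]
  refine Finset.sum_congr rfl fun i _ => ?_
  rw [ContinuousAlternatingMap.smul_apply, decomposable_apply]
  rfl

/-- Contraction with a vector that annihilates the second factor. -/
theorem wedge_decomposable_curryLeft {a b c : ℕ} (h : a + 1 + b = c + 1) (h' : a + b = c)
    (γ : AltForm V (a + 1)) (m : Fin b → V →L[ℝ] ℝ) (v : V) (hm : ∀ j, m j v = 0) :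
    (wedge h γ (decomposable m)).curryLeft v = wedge h' (γ.curryLeft v) (decomposable m) := by
  induction γ using decomposable_induction with
  | add x y hx hy => simp [hx, hy]
  | smul r x hx => simp [hx]
  | mem l =>
  rw [wedge_decomposable, decomposable_curryLeft, decomposable_curryLeft, map_sum,
    LinearMap.sum_apply, ← (finSumFinEquiv.trans (finCongr h)).sum_comp, Fintype.sum_sum_type]
  -- The terms of the Laplace expansion that remove a covector of the second factor vanish.
  have h0 : ∀ j : Fin b, joinArgs h l m ((finSumFinEquiv.trans (finCongr h)) (Sum.inr j)) v = 0 := by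
    intro j
    rw [joinArgs_apply]
    have : ¬ a + 1 + (j : ℕ) < a + 1 := by omega
    simpa [this] using hm j
  simp only [h0, mul_zero, zero_smul, Finset.sum_const_zero, add_zero]
  refine Finset.sum_congr rfl fun i _ => ?_
  rw [map_smul, LinearMap.smul_apply, wedge_decomposable]
  congr 1
  · rw [joinArgs_apply, dif_pos (by simpa using i.is_le)]
    rfl
  · congr 1
    funext k
    have hv : ∀ {d : ℕ} (i : Fin (d + 1)) (k : Fin d),
        ((i.succAbove k : Fin (d + 1)) : ℕ) = if (k : ℕ) < i then (k : ℕ) else k + 1 := by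
      intro d i k
      simp only [Fin.succAbove, Fin.lt_def, Fin.val_castSucc]
      split_ifs <;> simp
    have hi : (((finSumFinEquiv.trans (finCongr h)) (Sum.inl i) : Fin (c + 1)) : ℕ) = i := by simp
    have := i.2
    simp only [Function.comp_apply, joinArgs_apply, hv, hi]
    -- The removed index lies in the first block: below `a` the list skips it, and from `a` on every
    -- index is shifted by one.
    by_cases hk : (k : ℕ) < a
    · have : (if (k : ℕ) < i then (k : ℕ) else k + 1) < a + 1 := by split_ifs <;> omega
      rw [dif_pos this, dif_pos hk]
      congr 1
      ext
      simp [hv]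
    · have : ¬ (k : ℕ) < i := by omega
      simp only [this, if_false, add_lt_add_iff_right, hk, dite_false]
      congr 1
      ext
      simp

/-- If `θ ∧ m₁ ∧ ⋯ ∧ m_b = 0` and the covectors `mⱼ` vanish on all `vᵢ`, then
`θ (v₁, …, vₐ) m₁ ∧ ⋯ ∧ m_b = 0`. -/
theorem apply_smul_decomposable_eq_zero {a b c : ℕ} (h : a + b = c) (θ : AltForm V a)
    (m : Fin b → V →L[ℝ] ℝ) (hθ : wedge h θ (decomposable m) = 0) (v : Fin a → V)
    (hm : ∀ i j, m j (v i) = 0) : θ v • decomposable m = 0 := by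
  induction a generalizing c with
  | zero =>
    obtain rfl : b = c := by omega
    rwa [zero_form_wedge, Subsingleton.elim 0 v] at hθ
  | succ a ih =>
    obtain ⟨c, rfl⟩ : ∃ d, c = d + 1 := ⟨a + b, by omega⟩
    -- Inserting `v 0` into the vanishing product lowers the degree of `θ` by one and leaves the
    -- `mⱼ` untouched; in degree zero the wedge is multiplication by a scalar.
    have h1 := wedge_decomposable_curryLeft h (by omega) θ m (v 0) (hm 0)
    rw [hθ] at h1
    have h2 := ih (by omega) (θ.curryLeft (v 0)) (h1.symm.trans (by ext; simp)) (Fin.tail v)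
      fun i j => hm i.succ j
    have h3 : θ.curryLeft (v 0) (Fin.tail v) = θ v := by
      change θ (Fin.cons (v 0) (Fin.tail v)) = _
      rw [Fin.cons_self_tail]
    rwa [h3] at h2

/-- The form of `wedge_decomposable_curryLeft` that fits `contractT`, where vectors are elements of
`⋀¹ V`. -/
theorem contract_wedge_decomposable {b₁ b m₁ m e : ℕ} (h : 1 + m = b) (h₁ : 1 + m₁ = b₁)
    (h' : b₁ + e = b) (h'' : m₁ + e = m) (γ : AltForm V b₁) (l : Fin e → V →L[ℝ] ℝ) (v : V)
    (hl : ∀ j, l j v = 0) :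
    contract h (wedge h' γ (decomposable l)) ((exteriorPower.oneEquiv ℝ V).symm v) =
      wedge h'' (contract h₁ γ ((exteriorPower.oneEquiv ℝ V).symm v)) (decomposable l) := by
  obtain rfl : b = m + 1 := by omega
  obtain rfl : b₁ = m₁ + 1 := by omega
  have key : ∀ {k : ℕ} (hk : 1 + k = k + 1) (δ : AltForm V (k + 1)),
      contract hk δ ((exteriorPower.oneEquiv ℝ V).symm v) = δ.curryLeft v := by
    intro k hk δ
    have h1 : (exteriorPower.oneEquiv ℝ V).symm v = exteriorPower.ιMulti ℝ 1 fun _ => v := by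
      apply (exteriorPower.oneEquiv ℝ V).injective; simp
    ext w
    rw [h1, contract_ιMulti]
    change _ = δ (Fin.cons v w)
    congr 1
    funext i
    rw [joinArgs_apply]
    induction i using Fin.cases <;> simp
  rw [key, key, wedge_decomposable_curryLeft h' h'' γ l v hl]

end Decomposable

/-! ### Pullbacks, the choice of covectors, and the Leibniz rule on a vector space. -/

section ExteriorCalculus

variable {V : Type*} [NormedAddCommGroup V] [NormedSpace ℝ V] [FiniteDimensional ℝ V]
  {F : Type*} [NormedAddCommGroup F] [NormedSpace ℝ F] [FiniteDimensional ℝ F]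

theorem decomposable_compContinuousLinearMap {a : ℕ} (l : Fin a → F →L[ℝ] ℝ) (P : V →L[ℝ] F) :
    (decomposable l).compContinuousLinearMap P = decomposable fun j => (l j).comp P := by
  ext v
  rw [decomposable_apply]
  exact decomposable_apply _ _

theorem wedge_compContinuousLinearMap {a b c : ℕ} (h : a + b = c) (γ : AltForm F a)
    (η : AltForm F b) (P : V →L[ℝ] F) :
    (wedge h γ η).compContinuousLinearMap P =
      wedge h (γ.compContinuousLinearMap P) (η.compContinuousLinearMap P) := by
  have hadd : ∀ {d : ℕ} (x y : AltForm F d), (x + y).compContinuousLinearMap P =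
      x.compContinuousLinearMap P + y.compContinuousLinearMap P := fun _ _ => rfl
  have hsmul : ∀ {d : ℕ} (r : ℝ) (x : AltForm F d), (r • x).compContinuousLinearMap P =
      r • x.compContinuousLinearMap P := fun _ _ => rfl
  induction γ using decomposable_induction with
  | add x y hx hy => simp only [map_add, LinearMap.add_apply, hadd, hx, hy]
  | smul r x hx => simp only [map_smul, LinearMap.smul_apply, hsmul, hx]
  | mem l =>
  induction η using decomposable_induction with
  | add x y hx hy => simp only [map_add, hadd, hx, hy]
  | smul r x hx => simp only [map_smul, hsmul, hx]
  | mem m =>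
  simp only [wedge_decomposable, decomposable_compContinuousLinearMap]
  congr 1
  funext k
  simp only [joinArgs_apply]
  split_ifs <;> rfl

/-- In dimension `a + e`, the vectors `v₁, …, vₐ` are annihilated by `e` independent covectors. -/
theorem exists_decomposable_ne_zero {a e : ℕ} (hF : Module.finrank ℝ F = a + e) (P : V →L[ℝ] F)
    (hP : Function.Surjective P) (v : Fin a → V) :
    ∃ l : Fin e → F →L[ℝ] ℝ, (∀ i j, l j (P (v i)) = 0) ∧
      decomposable (fun j => (l j).comp P) ≠ 0 := by
  let U := Submodule.span ℝ (Set.range (P ∘ v))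
  have hU : Module.finrank ℝ U ≤ a :=
    (finrank_range_le_card (R := ℝ) (P ∘ v)).trans_eq (Fintype.card_fin a)
  -- The covectors sought are coordinates on the quotient by the span `U` of the images of the `vᵢ`;
  -- as `dim U ≤ a`, at least `e` are available.
  have hd : e ≤ Module.finrank ℝ (F ⧸ U) := by
    have := U.finrank_quotient_add_finrank
    omega
  let b := Module.finBasis ℝ (F ⧸ U)
  choose w hw using fun j => (U.mkQ_surjective.comp hP) (b j)
  refine ⟨fun j => LinearMap.toContinuousLinearMap (b.coord (Fin.castLE hd j) ∘ₗ U.mkQ),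
    fun i j => ?_, fun h0 => ?_⟩
  · have : U.mkQ (P (v i)) = 0 := by
      rw [Submodule.mkQ_apply, Submodule.Quotient.mk_eq_zero]
      exact Submodule.subset_span ⟨i, rfl⟩
    change b.coord _ (U.mkQ (P (v i))) = 0
    rw [this, map_zero]
  -- Evaluated on lifts `w` of the dual basis vectors, the product is the determinant of the
  -- identity matrix.
  · have h1 := congrArg (fun γ => γ fun k => w (Fin.castLE hd k)) h0
    simp only [decomposable_apply] at h1
    have h2 : (Matrix.of fun i j : Fin e => ((LinearMap.toContinuousLinearMap
        (b.coord (Fin.castLE hd i) ∘ₗ U.mkQ)).comp P) (w (Fin.castLE hd j))) = 1 := by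
      ext i j
      change b.coord _ ((U.mkQ ∘ P) (w (Fin.castLE hd j))) = _
      rw [hw, Module.Basis.coord_apply, Module.Basis.repr_self, Matrix.one_apply,
        Finsupp.single_apply]
      simp [Fin.ext_iff, eq_comm]
    rw [h2, Matrix.det_one] at h1
    exact one_ne_zero h1

-- The derivative of a field of forms is a linear map `V → ⋀ᵃ V*`, that is, a sum of tensors `t ⊗
-- (l₁ ∧ ⋯ ∧ lₐ)`, and the exterior derivative is its alternatization. The Leibniz rule is checked
-- on such tensors.
@[elab_as_elim]
theorem smulRight_decomposable_induction {a : ℕ} {P : (V →L[ℝ] AltForm V a) → Prop}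
    (mem : ∀ (t : V →L[ℝ] ℝ) (l : Fin a → V →L[ℝ] ℝ), P (ContinuousLinearMap.smulRight t (decomposable l)))
    (add : ∀ A B, P A → P B → P (A + B)) (smul : ∀ (r : ℝ) A, P A → P (r • A)) (A : V →L[ℝ] AltForm V a) : P A := by
  have hz : P 0 := by
    have h : ContinuousLinearMap.smulRight (0 : V →L[ℝ] ℝ) (decomposable (0 : Fin a → V →L[ℝ] ℝ)) =
        (0 : V →L[ℝ] AltForm V a) := by ext1 v; simp
    exact h ▸ mem 0 0
  let b := Module.finBasis ℝ V
  have hA : A = ∑ i, ContinuousLinearMap.smulRight (LinearMap.toContinuousLinearMap (b.coord i))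
      (A (b i)) := by
    ext1 v
    conv_lhs => rw [← b.sum_repr v, map_sum]
    simp [_root_.sum_apply, Module.Basis.coord_apply]
  rw [hA]
  refine Finset.sum_induction _ P add hz fun i _ => ?_
  generalize A (b i) = γ
  generalize LinearMap.toContinuousLinearMap (b.coord i) = t
  induction γ using decomposable_induction with
  | mem l => exact mem t l
  | add x y hx hy =>
    have : ContinuousLinearMap.smulRight t (x + y) =
      ContinuousLinearMap.smulRight t x + ContinuousLinearMap.smulRight t y := by
        ext1 v; simp
    rw [this]; exact add _ _ hx hy
  | smul r x hx =>
    have : ContinuousLinearMap.smulRight t (r • x) = r • ContinuousLinearMap.smulRight t x := by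
        ext1 v; simp [smul_comm r]
    rw [this]; exact smul _ _ hx

/-- Laplace expansion along the first row, which holds the values of `t`. -/
theorem alternatizeUncurryFin_smulRight_decomposable {a : ℕ} (t : V →L[ℝ] ℝ)
    (l : Fin a → V →L[ℝ] ℝ) :
    ContinuousAlternatingMap.alternatizeUncurryFin
      (ContinuousLinearMap.smulRight t (decomposable l)) =
        decomposable (Fin.cons t l : Fin (a + 1) → V →L[ℝ] ℝ) := by
  ext v
  rw [ContinuousAlternatingMap.alternatizeUncurryFin_apply, decomposable_apply,
    Matrix.det_succ_row_zero]
  refine Finset.sum_congr rfl fun i _ => ?_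
  rw [ContinuousLinearMap.smulRight_apply, ContinuousAlternatingMap.smul_apply,
    decomposable_apply, zsmul_eq_mul, smul_eq_mul]
  push_cast
  rw [← mul_assoc]
  rfl

/-- The exterior product as a continuous bilinear map. -/
def wedgeL {a b c : ℕ} (h : a + b = c) : AltForm V a →L[ℝ] AltForm V b →L[ℝ] AltForm V c :=
  (wedge h).toContinuousBilinearMap

@[simp] theorem wedgeL_apply {a b c : ℕ} (h : a + b = c) (γ : AltForm V a) (η : AltForm V b) :
    wedgeL h γ η = wedge h γ η := rfl

/-- The half of the Leibniz rule in which the first factor is differentiated: the new covector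
already stands in front, so no sign appears. -/
theorem alternatizeUncurryFin_wedge_left {a b c : ℕ} (h : a + b = c) (h' : a + 1 + b = c + 1)
    (A : V →L[ℝ] AltForm V a) (η : AltForm V b) :
    ContinuousAlternatingMap.alternatizeUncurryFin ((wedgeL h).flip η ∘L A) =
      wedge h' (ContinuousAlternatingMap.alternatizeUncurryFin A) η := by
  induction A using smulRight_decomposable_induction with
  | add A B hA hB =>
    rw [ContinuousLinearMap.comp_add, ContinuousAlternatingMap.alternatizeUncurryFin_add, hA, hB,
      ContinuousAlternatingMap.alternatizeUncurryFin_add, map_add, LinearMap.add_apply]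
  | smul r A hA =>
    rw [ContinuousLinearMap.comp_smul, ContinuousAlternatingMap.alternatizeUncurryFin_smul, hA,
      ContinuousAlternatingMap.alternatizeUncurryFin_smul, map_smul, LinearMap.smul_apply]
  | mem t l =>
  have hcomp : ∀ ζ, (wedgeL h).flip ζ ∘L ContinuousLinearMap.smulRight t (decomposable l) =
      ContinuousLinearMap.smulRight t (wedge h (decomposable l) ζ) := by
    intro ζ; ext1 v; simp
  rw [hcomp, alternatizeUncurryFin_smulRight_decomposable]
  induction η using decomposable_induction with
  | add x y hx hy =>
    have : ContinuousLinearMap.smulRight t (wedge h (decomposable l) (x + y)) =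
        ContinuousLinearMap.smulRight t (wedge h (decomposable l) x) +
        ContinuousLinearMap.smulRight t (wedge h (decomposable l) y) := by ext1 v; simp
    rw [this, ContinuousAlternatingMap.alternatizeUncurryFin_add, hx, hy, map_add]
  | smul r x hx =>
    have : ContinuousLinearMap.smulRight t (wedge h (decomposable l) (r • x)) =
        r • ContinuousLinearMap.smulRight t (wedge h (decomposable l) x) := by
      ext1 v; simp [smul_comm r]
    rw [this, ContinuousAlternatingMap.alternatizeUncurryFin_smul, hx, map_smul]
  | mem m =>
  rw [wedge_decomposable, wedge_decomposable, alternatizeUncurryFin_smulRight_decomposable]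
  congr 1
  funext k
  induction k using Fin.cases with
  | zero => simp [joinArgs_apply]
  | succ k =>
    simp only [Fin.cons_succ, joinArgs_apply, Fin.val_succ, add_lt_add_iff_right]
    split_ifs
    · rfl
    · congr 1; apply Fin.ext; dsimp; omega

theorem decomposable_comp_perm {a : ℕ} (l : Fin a → V →L[ℝ] ℝ) (σ : Equiv.Perm (Fin a)) :
    decomposable (l ∘ σ) = ((Equiv.Perm.sign σ : ℤ) : ℝ) • decomposable l := by
  ext v
  rw [ContinuousAlternatingMap.smul_apply, decomposable_apply, decomposable_apply]
  exact Matrix.det_permute σ (Matrix.of fun i j => l i (v j))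

/-- Here the new covector must be moved past the `a` covectors of `γ`; `s` is the sign of that
permutation. Its value does not matter, since it will only multiply `dε = 0`. -/
theorem alternatizeUncurryFin_wedge_right {a b : ℕ} : ∃ s : ℝ,
    ∀ (γ : AltForm V a) (B : V →L[ℝ] AltForm V b),
      ContinuousAlternatingMap.alternatizeUncurryFin (wedgeL rfl γ ∘L B) =
        s • wedge (rfl : a + (b + 1) = a + b + 1) γ
          (ContinuousAlternatingMap.alternatizeUncurryFin B) := by
  obtain ⟨σ, hσ⟩ := joinArgs_cons (V := V →L[ℝ] ℝ) (p := a) (m := b)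
  refine ⟨((Equiv.Perm.sign σ : ℤ) : ℝ), fun γ B => ?_⟩
  induction B using smulRight_decomposable_induction with
  | add A B hA hB =>
    rw [ContinuousLinearMap.comp_add, ContinuousAlternatingMap.alternatizeUncurryFin_add, hA, hB,
      ContinuousAlternatingMap.alternatizeUncurryFin_add, map_add, smul_add]
  | smul r A hA =>
    rw [ContinuousLinearMap.comp_smul, ContinuousAlternatingMap.alternatizeUncurryFin_smul, hA,
      ContinuousAlternatingMap.alternatizeUncurryFin_smul, map_smul, smul_comm]
  | mem t m =>
  have hcomp : ∀ ζ, wedgeL rfl ζ ∘L ContinuousLinearMap.smulRight t (decomposable m) =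
      ContinuousLinearMap.smulRight t (wedge (rfl : a + b = a + b) ζ (decomposable m)) := by
    intro ζ; ext1 v; simp
  rw [hcomp, alternatizeUncurryFin_smulRight_decomposable]
  induction γ using decomposable_induction with
  | add x y hx hy =>
    have : ContinuousLinearMap.smulRight t (wedge rfl (x + y) (decomposable m)) =
        ContinuousLinearMap.smulRight t (wedge (rfl : a + b = a + b) x (decomposable m)) +
        ContinuousLinearMap.smulRight t (wedge (rfl : a + b = a + b) y (decomposable m)) := by
      ext1 v; simp
    rw [this, ContinuousAlternatingMap.alternatizeUncurryFin_add, hx, hy, map_add,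
      LinearMap.add_apply, smul_add]
  | smul r x hx =>
    have : ContinuousLinearMap.smulRight t (wedge rfl (r • x) (decomposable m)) =
        r • ContinuousLinearMap.smulRight t (wedge (rfl : a + b = a + b) x (decomposable m)) := by
      ext1 v; simp [smul_comm r]
    rw [this, ContinuousAlternatingMap.alternatizeUncurryFin_smul, hx, map_smul,
      LinearMap.smul_apply, smul_comm]
  | mem l =>
  rw [wedge_decomposable, wedge_decomposable, alternatizeUncurryFin_smulRight_decomposable,
    hσ, decomposable_comp_perm, smul_smul]
  have : ((Equiv.Perm.sign σ : ℤ) : ℝ) * ((Equiv.Perm.sign σ : ℤ) : ℝ) = 1 := by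
    rw [← Int.cast_mul, Int.units_coe_mul_self, Int.cast_one]
  rw [this, one_smul]

/-- `d (α ∧ ε) = dα ∧ ε` at points where `dε = 0`. -/
theorem extDeriv_wedge_of_extDeriv_eq_zero {a b : ℕ} (h : a + 1 + b = a + b + 1)
    {α : V → AltForm V a} {ε : V → AltForm V b} {y : V} (hα : DifferentiableAt ℝ α y)
    (hε : DifferentiableAt ℝ ε y) (hd : extDeriv ε y = 0) :
    extDeriv (fun z => wedge (rfl : a + b = a + b) (α z) (ε z)) y =
      wedge h (extDeriv α y) (ε y) := by
  obtain ⟨s, hs⟩ := alternatizeUncurryFin_wedge_right (V := V) (a := a) (b := b)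
  have h1 := ((wedgeL (V := V) (rfl : a + b = a + b)).hasFDerivAt_of_bilinear
    hα.hasFDerivAt hε.hasFDerivAt).fderiv
  -- The product rule for the bilinear wedge; the two summands are alternatized separately.
  have h2 : fderiv ℝ (fun z => wedge (rfl : a + b = a + b) (α z) (ε z)) y =
      wedgeL rfl (α y) ∘L fderiv ℝ ε y + (wedgeL rfl).flip (ε y) ∘L fderiv ℝ α y := by
    refine h1.trans ?_
    ext1 v
    simp [ContinuousLinearMap.precompR, ContinuousLinearMap.precompL]
  rw [extDeriv, h2, ContinuousAlternatingMap.alternatizeUncurryFin_add, hs,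
    alternatizeUncurryFin_wedge_left rfl h]
  change s • wedge _ (α y) (extDeriv ε y) + _ = _
  rw [hd, map_zero, smul_zero, zero_add]
  rfl

end ExteriorCalculus

/-! ### Smooth closed forms on a manifold obtained from constant forms. -/

section PulledBackForms

variable {E : Type*} [NormedAddCommGroup E] [NormedSpace ℝ E] [FiniteDimensional ℝ E]
  {M : Type*} [TopologicalSpace M] [ChartedSpace E M]
  {F : Type*} [NormedAddCommGroup F] [NormedSpace ℝ F] [FiniteDimensional ℝ F]
  {X : Type*} [TopologicalSpace X] [ChartedSpace F X]

/-- A form is recovered from its finitely many coefficients in a basis by a linear left inverse,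
which is smooth in finite dimension. -/
theorem contDiffAt_altForm_iff {a : ℕ} {θ : E → AltForm F a} {y : E} :
    ContDiffAt ℝ ∞ θ y ↔ ∀ v, ContDiffAt ℝ ∞ (fun z => θ z v) y := by
  refine ⟨fun h v => ?_, fun h => ?_⟩
  · exact (ContinuousAlternatingMap.apply ℝ F ℝ v).contDiff.contDiffAt.comp y h
  · let b := Module.finBasis ℝ F
    let A : AltForm F a →ₗ[ℝ] ((Fin a → Fin (Module.finrank ℝ F)) → ℝ) :=
      { toFun := fun γ r => γ fun i => b (r i)
        map_add' := fun _ _ => rfl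
        map_smul' := fun _ _ => rfl }
    have hA : LinearMap.ker A = ⊥ := by
      rw [LinearMap.ker_eq_bot']
      intro γ hγ
      apply ContinuousAlternatingMap.toAlternatingMap_injective
      apply AlternatingMap.coe_multilinearMap_injective
      exact Module.Basis.ext_multilinear (fun _ => b) fun r => congrFun hγ r
    obtain ⟨B, hB⟩ := A.exists_leftInverse_of_injective hA
    have h1 : ContDiffAt ℝ ∞ (fun z => A (θ z)) y := contDiffAt_pi.mpr fun r => h _
    have h2 := (LinearMap.toContinuousLinearMap B).contDiff.contDiffAt.comp y h1
    have h3 : (fun z => B (A (θ z))) = θ := funext fun z => LinearMap.congr_fun hB (θ z)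
    exact h3 ▸ h2

/-- The pullback of a constant form by a map to a vector space. -/
def pullbackConst (g : M → F) {a : ℕ} (c : AltForm F a) (x : M) : AltForm E a :=
  c.compContinuousLinearMap (mfderiv 𝓘(ℝ, E) 𝓘(ℝ, F) g x : E →L[ℝ] F)

variable [IsManifold 𝓘(ℝ, E) ∞ M]

theorem contDiffAt_comp_extChartAt_symm {g : M → F} (hg : ContMDiff 𝓘(ℝ, E) 𝓘(ℝ, F) ∞ g) (x : M) :
    ContDiffAt ℝ ∞ (g ∘ (extChartAt 𝓘(ℝ, E) x).symm) (extChartAt 𝓘(ℝ, E) x x) := by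
  rw [← contMDiffAt_iff_contDiffAt]
  have h1 : ContMDiffAt 𝓘(ℝ, E) 𝓘(ℝ, E) ∞ (extChartAt 𝓘(ℝ, E) x).symm (extChartAt 𝓘(ℝ, E) x x) :=
    (contMDiffOn_extChartAt_symm x).contMDiffAt (extChartAt_target_mem_nhds x)
  exact hg.contMDiffAt.comp _ h1

theorem mdifferentiableAt_extChartAt_symm_of_mem {x : M} {y : E}
    (hy : y ∈ (extChartAt 𝓘(ℝ, E) x).target) :
    MDifferentiableAt 𝓘(ℝ, E) 𝓘(ℝ, E) (extChartAt 𝓘(ℝ, E) x).symm y :=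
  ((contMDiffOn_extChartAt_symm (n := ∞) x).contMDiffAt
    ((isOpen_extChartAt_target x).mem_nhds hy)).mdifferentiableAt (by simp)

/-- The chain rule, applied on the chart target, where the inverse chart is smooth; the germ
suffices for smoothness and for `extDeriv`. -/
theorem chartRep_pullbackConst {g : M → F} (hg : ContMDiff 𝓘(ℝ, E) 𝓘(ℝ, F) ∞ g) {a : ℕ}
    (c : AltForm F a) (x : M) :
    chartRep (pullbackConst g c) x =ᶠ[𝓝 (extChartAt 𝓘(ℝ, E) x x)] fun y =>
      c.compContinuousLinearMap (fderiv ℝ (g ∘ (extChartAt 𝓘(ℝ, E) x).symm) y) := by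
  filter_upwards [extChartAt_target_mem_nhds (I := 𝓘(ℝ, E)) x] with y hy
  have h1 := mfderiv_comp y (hg.mdifferentiableAt (by simp) :
    MDifferentiableAt 𝓘(ℝ, E) 𝓘(ℝ, F) g ((extChartAt 𝓘(ℝ, E) x).symm y))
    (mdifferentiableAt_extChartAt_symm_of_mem hy)
  rw [mfderiv_eq_fderiv] at h1
  rw [h1]
  rfl

theorem smoothForm_pullbackConst {g : M → F} (hg : ContMDiff 𝓘(ℝ, E) 𝓘(ℝ, F) ∞ g) {a : ℕ}
    (c : AltForm F a) : SmoothForm (pullbackConst (E := E) g c) := by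
  intro x
  refine ContDiffAt.congr_of_eventuallyEq ?_ (chartRep_pullbackConst hg c x)
  rw [contDiffAt_altForm_iff]
  intro v
  have h1 : ContDiffAt ℝ ∞ (fderiv ℝ (g ∘ (extChartAt 𝓘(ℝ, E) x).symm))
      (extChartAt 𝓘(ℝ, E) x x) :=
    (contDiffAt_comp_extChartAt_symm hg x).fderiv_right (by simp)
  exact c.toContinuousMultilinearMap.contDiff.contDiffAt.comp _
    (contDiffAt_pi.mpr fun i => h1.clm_apply contDiffAt_const)

/-- The exterior derivative commutes with pullback by a map of class C², and a constant form is
closed. -/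
theorem extDeriv_chartRep_pullbackConst {g : M → F} (hg : ContMDiff 𝓘(ℝ, E) 𝓘(ℝ, F) ∞ g) {a : ℕ}
    (c : AltForm F a) (x : M) :
    extDeriv (chartRep (pullbackConst g c) x) (extChartAt 𝓘(ℝ, E) x x) = 0 := by
  rw [(chartRep_pullbackConst hg c x).extDeriv_eq]
  have h1 := extDeriv_pullback
    (differentiableAt_const (𝕜 := ℝ) (x := (g ∘ (extChartAt 𝓘(ℝ, E) x).symm) _) c) (contDiffAt_comp_extChartAt_symm hg x) (by
      rw [minSmoothness_of_isRCLikeNormedField]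
      exact WithTop.coe_le_coe.mpr (le_top : (2 : ℕ∞) ≤ ⊤))
  refine h1.trans ?_
  ext v
  simp [extDeriv, ContinuousAlternatingMap.alternatizeUncurryFin_apply]

theorem extD_pullbackConst {g : M → F} (hg : ContMDiff 𝓘(ℝ, E) 𝓘(ℝ, F) ∞ g) {a : ℕ}
    (c : AltForm F a) (x : M) : extD (pullbackConst (E := E) g c) x = 0 := by
  rw [extD, extDeriv_chartRep_pullbackConst hg c x]
  rfl

/-- The differentials of the chart and of its inverse cancel at the centre. This brings the
undifferentiated factor of a Leibniz rule in the chart back to `M`. -/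
theorem chartRep_self_comp_chartDeriv {a : ℕ} (θ : M → AltForm E a) (x : M) :
    (chartRep θ x (extChartAt 𝓘(ℝ, E) x x)).compContinuousLinearMap (chartDeriv x x) = θ x := by
  have h1 := mfderivWithin_extChartAt_symm_comp_mfderiv_extChartAt' (I := 𝓘(ℝ, E))
    (mem_extChartAt_source (I := 𝓘(ℝ, E)) x)
  rw [show Set.range 𝓘(ℝ, E) = Set.univ by simp, mfderivWithin_univ] at h1
  have h2 : ∀ v, chartSymmDeriv x (extChartAt 𝓘(ℝ, E) x x) (chartDeriv x x v) = v :=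
    fun v => DFunLike.congr_fun h1 v
  ext v
  change θ _ (fun i => chartSymmDeriv x _ (chartDeriv x x (v i))) = _
  simp only [h2, extChartAt_to_inv]

/-- `d (α ∧ ε) = dα ∧ ε` for the pullback `ε` of a constant form. -/
theorem extD_wedgeField_pullbackConst {g : M → F} (hg : ContMDiff 𝓘(ℝ, E) 𝓘(ℝ, F) ∞ g) {a b : ℕ}
    (h : a + 1 + b = a + b + 1) {α : M → AltForm E a} (hα : SmoothForm α) (c : AltForm F b) (x : M) :
    extD (wedgeField α (pullbackConst g c)) x = wedge h (extD α x) (pullbackConst g c x) := by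
  have h1 : chartRep (wedgeField α (pullbackConst g c)) x = fun z =>
      wedge (rfl : a + b = a + b) (chartRep α x z) (chartRep (pullbackConst g c) x z) :=
    funext fun z => wedge_compContinuousLinearMap rfl _ _ _
  rw [extD, h1, extDeriv_wedge_of_extDeriv_eq_zero h ((hα x).differentiableAt (by simp))
    ((smoothForm_pullbackConst hg c x).differentiableAt (by simp))
    (extDeriv_chartRep_pullbackConst hg c x), wedge_compContinuousLinearMap,
    chartRep_self_comp_chartDeriv]
  rfl

/-- A manifold admits near each point a globally smooth map to its model space that is a local
coordinate system. -/
theorem exists_contMDiff_surjective_mfderiv [T2Space M] (x : M) :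
    ∃ f : M → E, ContMDiff 𝓘(ℝ, E) 𝓘(ℝ, E) ∞ f ∧
      Function.Surjective (mfderiv 𝓘(ℝ, E) 𝓘(ℝ, E) f x) := by
  let ρ : SmoothBumpFunction 𝓘(ℝ, E) x := Classical.arbitrary _
  refine ⟨fun z => ρ z • extChartAt 𝓘(ℝ, E) x z, ρ.contMDiff_smul contMDiffOn_extChartAt, ?_⟩
  -- The bump function is `1` near `x`, so the cut-off map has the differential of the chart there.
  have h1 : (fun z => ρ z • extChartAt 𝓘(ℝ, E) x z) =ᶠ[𝓝 x] extChartAt 𝓘(ℝ, E) x := by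
    filter_upwards [ρ.eventuallyEq_one] with z hz
    simp [hz]
  rw [h1.mfderiv_eq]
  have h2 := mfderiv_extChartAt_comp_mfderivWithin_extChartAt_symm' (I := 𝓘(ℝ, E))
    (mem_extChartAt_source (I := 𝓘(ℝ, E)) x)
  exact fun w => ⟨_, DFunLike.congr_fun h2 w⟩

/-- Supplies the test forms: by the chain rule they are `τ^*` of the pullback by `f`, which is
smooth on all of `X` because `f` is. -/
theorem isBasic_pullbackConst_comp [IsManifold 𝓘(ℝ, F) ∞ X] {τ : M → X}
    (hτ : ContMDiff 𝓘(ℝ, E) 𝓘(ℝ, F) ∞ τ) {f : X → F} (hf : ContMDiff 𝓘(ℝ, F) 𝓘(ℝ, F) ∞ f) {a : ℕ}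
    (c : AltForm F a) : IsBasic F τ (pullbackConst (E := E) (f ∘ τ) c) := by
  refine ⟨pullbackConst f c, smoothForm_pullbackConst hf c, funext fun x => ?_⟩
  rw [pullbackConst, mfderiv_comp x (hf.mdifferentiableAt (by simp))
    (hτ.mdifferentiableAt (by simp))]
  rfl

end PulledBackForms

/-! ### Vertical contraction and semi-basic factors. -/

section Uniqueness

variable {E : Type*} [NormedAddCommGroup E] [NormedSpace ℝ E] [FiniteDimensional ℝ E]
  {M : Type*} [TopologicalSpace M] [ChartedSpace E M]
  {F : Type*} [NormedAddCommGroup F] [NormedSpace ℝ F]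
  {X : Type*} [TopologicalSpace X] [ChartedSpace F X] {n : ℕ}

/-- Contraction with a vertical-valued `T ∈ ⋀ᵏ M ⊗ TM / K₁` commutes with the exterior product by a
product of covectors that vanish on vertical vectors. -/
theorem GradedSubbundle.contractT_wedge_decomposable (B : GradedSubbundle E M n) (τ : M → X) (x : M)
    {k b₁ b m₁ m e c₁ c : ℕ} (hb₁ : b₁ ≤ n) (hb : b ≤ n) (h₁ : 1 + m₁ = b₁) (h : 1 + m = b)
    (hc₁ : k + m₁ = c₁) (hc : k + m = c) (h' : b₁ + e = b) (h'' : c₁ + e = c)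
    (γ : AltForm E b₁) (hγ : γ ∈ B.S b₁ x) (l : Fin e → E →L[ℝ] ℝ)
    (hγl : wedge h' γ (decomposable l) ∈ B.S b x)
    (hl : ∀ v ∈ vertical F τ x, ∀ j, l j v = 0) {T : AltForm E k ⊗[ℝ] B.Q 1 x}
    (hT : T ∈ LinearMap.range (TensorProduct.map (LinearMap.id : AltForm E k →ₗ[ℝ] AltForm E k)
      ((B.K 1 x).mkQ ∘ₗ (verticalMultiVec F τ x).subtype))) :
    B.contractT le_rfl hb h hc x _ hγl T =
      wedge h'' (B.contractT le_rfl hb₁ h₁ hc₁ x γ hγ T) (decomposable l) := by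
  obtain ⟨t, rfl⟩ := hT
  induction t using TensorProduct.induction_on with
  | zero => simp
  | add s t hs ht => simp only [map_add, hs, ht, LinearMap.add_apply]
  | tmul θ u =>
    obtain ⟨_, v, hv, rfl⟩ := u
    change wedge hc θ (contract h (wedge h' γ (decomposable l))
        ((exteriorPower.oneEquiv ℝ E).symm v)) =
      wedge h'' (wedge hc₁ θ (contract h₁ γ ((exteriorPower.oneEquiv ℝ E).symm v)))
        (decomposable l)
    -- For `θ ⊗ v` with `v` vertical, the contraction does not see the covectors `l`, and `θ ∧`
    -- passes by associativity.
    rw [contract_wedge_decomposable h h₁ h' (by omega) γ l v (hl v hv),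
      wedge_assoc hc₁ h'' (by omega) hc]

end Uniqueness

end GradedDirac

end

/-! ### The theorem. -/

open GradedDirac in
theorem mainTheorem4
    {E : Type*} [NormedAddCommGroup E] [NormedSpace ℝ E] [FiniteDimensional ℝ E]
    {M : Type*} [TopologicalSpace M] [ChartedSpace E M] [IsManifold 𝓘(ℝ, E) ∞ M] [T2Space M]
    {F : Type*} [NormedAddCommGroup F] [NormedSpace ℝ F] [FiniteDimensional ℝ F]
    {X : Type*} [TopologicalSpace X] [ChartedSpace F X] [IsManifold 𝓘(ℝ, F) ∞ X] [T2Space X]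
    {n : ℕ} (τ : M → X) (D : GradedDiracStructure E M n) (hD : D.IsFibered F τ)
    {a : ℕ} (α : M → AltForm E a) (hα : D.IsSpecialHamiltonian F τ α)
    (H : M → AltForm E n) (hH : D.IsHamiltonian F τ H)
    (s s' : D.SharpExtension (Nat.add_comm 1 n))
    (hs : s.IsVerticalValued F τ) (hs' : s'.IsVerticalValued F τ) :
    D.bracket s α hα.isHamiltonianForm H hH.mem =
      D.bracket s' α hα.isHamiltonianForm H hH.mem := by
  have hα' := hα.isHamiltonianForm
  -- `e` is the degree of the test forms.
  obtain ⟨e, rfl⟩ : ∃ e, n = a + e + 1 := ⟨n - 1 - a, by have := hα'.degree_lt; omega⟩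
  funext x
  unfold GradedDiracStructure.bracket
  congr 1
  rw [← sub_eq_zero]
  set Θ : D.extDomain (Nat.add_comm 1 (a + e + 1)) x := ⟨extD H x, hH.mem x⟩
  obtain ⟨f, hf, hfx⟩ := exists_contMDiff_surjective_mfderiv (E := F) (τ x)
  have hτ := hD.isFiberedManifold.smooth
  -- `P` is onto and kills vertical vectors, so covectors of `F` pull back along it to semi-basic
  -- covectors at `x`.
  let P : E →L[ℝ] F := mfderiv 𝓘(ℝ, E) 𝓘(ℝ, F) (f ∘ τ) x
  have hP : ∀ v, P v = mfderiv 𝓘(ℝ, F) 𝓘(ℝ, F) f (τ x) (mfderiv 𝓘(ℝ, E) 𝓘(ℝ, F) τ x v) := by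
    intro v
    change (mfderiv 𝓘(ℝ, E) 𝓘(ℝ, F) (f ∘ τ) x) v = _
    rw [mfderiv_comp x (hf.mdifferentiableAt (by simp)) (hτ.mdifferentiableAt (by simp))]
    rfl
  have hPsurj : Function.Surjective P := by
    intro w
    obtain ⟨u, hu⟩ := hfx w
    obtain ⟨v, hv⟩ := hD.isFiberedManifold.submersion x u
    exact ⟨v, (hP v).trans ((congrArg _ hv).trans hu)⟩
  have hPvert : ∀ v ∈ vertical F τ x, P v = 0 := by
    intro v hv
    have hv0 : mfderiv 𝓘(ℝ, E) 𝓘(ℝ, F) τ x v = 0 := hv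
    exact (hP v).trans ((congrArg _ hv0).trans (map_zero _))
  ext v
  -- The covectors depend on the arguments `v` at which the difference is tested.
  obtain ⟨l, hlv, hl⟩ := exists_decomposable_ne_zero (a := 1 + a) (e := e)
    (by rw [hD.finrank_base]; omega) P hPsurj v
  refine (smul_eq_zero.mp (apply_smul_decomposable_eq_zero (c := a + e + 1) (by omega) _
    (fun j => (l j).comp P) ?_ v hlv)).resolve_right hl
  have hbasic := isBasic_pullbackConst_comp hτ hf (decomposable l)
  have hfτ := hf.comp hτ
  have hε : pullbackConst (E := E) (f ∘ τ) (decomposable l) x =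
      decomposable fun j => (l j).comp P := decomposable_compContinuousLinearMap l P
  have hmem := (hα.wedge_mem e (by omega) _ hbasic fun y => extD_pullbackConst hfτ _ y).mem x
  -- `hmem` now says that `dα ∧ ε` lies in `Sⁿ` at `x`, the degree in which extensions are
  -- prescribed.
  rw [extD_wedgeField_pullbackConst hfτ (by omega) hα'.smooth, hε] at hmem
  have hcomm := fun T hT => D.contractT_wedge_decomposable (F := F) τ x hα'.degree_lt le_rfl
    (Nat.add_comm 1 a) D.sub_one_add rfl (D.add_sub_one (Nat.add_comm 1 _)) (by omega)
    (by omega : 1 + a + e = a + e + 1) _ (hα'.mem x) _ hmem (fun v hv j => by simp [hPvert v hv])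
    (T := T) hT
  rw [map_sub, LinearMap.sub_apply, ← hcomm _ (hs x Θ), ← hcomm _ (hs' x Θ), sub_eq_zero]
  -- Both contractions of `dα ∧ ε` equal its contraction with `♯̃₁(dH)`.
  exact (s.isSharpValue x Θ _ hmem).trans (s'.isSharpValue x Θ _ hmem).symm
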